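/- **Setting.** A neural network $\Phi$ with input dimension $d\ge 1$, output dimension $s\ge 1$ and $L\ge 1$ layers is a sequence $((W^1,b^1),\dots,(W^L,b^L))$ with $W^\ell\in\mathbb R^{n_\ell\times n_{\ell-1}}$, $b^\ell\in\mathbb R^{n_\ell}$, $n_0=d$, $n_L=s$. Its ReLU realisation is $R\Phi=A_L\circ\varrho\circ A_{L-1}\circ\cdots\circ\varrho\circ A_1:\mathbb R^d\to\mathbb R^s$, where $A_\ell x=W^\ell x+b^\ell$ and $\varrho(x)=\max(x,0)$ acts componentwise. Put $\operatorname{Depth}(\Phi)=L$ and $\operatorname{Size}(\Phi)=\|\Phi\|_0$, the number of nonzero entries of all $W^\ell$ and $b^\ell$. Let $T>0$, let $W=(W_t)_{t\in[0,T]}$ be a real Brownian motion on a probability space, let $(e_i)_{i\ge 0}$ be an orthonormal system in $L^2([0,T])$ (for instance an orthonormal basis such as the Haar basis), and let $G_i=\int_0^T e_i(s)\,\mathrm dW_s$ be the Wiener integrals. Let $H_n(x)=\frac{(-1)^n}{\sqrt{n!}}e^{x^2/2}\frac{\mathrm d^n}{\mathrm dx^n}e^{-x^2/2}$ be the normalised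 Hermite polynomials. For a finitely supported multi-index $\alpha\in\mathbb N^{\infty}$ let $\Psi_\alpha=\prod_i H_{\alpha_i}(G_i)$, $|\alpha|=\sum_i\alpha_i$, and $|\alpha|_0=\#\{i:\alpha_i\ne 0\}$. **Statement.** There is an absolute constant $C>0$ with the following property. Let $T,W,(e_i)$ be as above, let $p,m\ge 1$ be integers, let $k_1^*,\dots,k_p^*$ be any multi-indices supported in $\{0,\dots,m-1\}$ (in particular, the indices of a best $p$-term chaos approximation of a stochastic process), and let $\varepsilon\in(0,e^{-1}/p)$. Then there is a neural network $\Phi_\varepsilon$ with input dimension $m$ and output dimension $p$ such that, evaluating the realisation at the random input, $R\Phi_\varepsilon=R\Phi_\varepsilon(G_0,\dots,G_{m-1})$, $$\mathbb E\Big[\sum_{j=1}^p|\Psi_{k_j^*}-(R\Phi_\varepsilon)_j|^2\Big]\le\varepsilon$$ and, provided that not all $k_j^*$ are zero, $$\operatorname{Size}(\Phi_\varepsilon)\le C\,p\,\max_{1\le j\le p}\Big(|k_j^*|^3\log(1+|k_j^*|)\,|k_j^*|_0^2\Big)\log(p\,\varepsilon^{-1}),$$ $$\operatorname{Depth}(\Phi_\varepsilon)\le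 C\max_{1\le j\le p}\Big(|k_j^*|\log(1+|k_j^*|)^2\,|k_j^*|_0\log(1+|k_j^*|_0)\Big)\log(p\,\varepsilon^{-1}).$$ Moreover, every neural network $\Phi_\varepsilon$ with input dimension $m$ and output dimension $p$ that satisfies the first inequality satisfies $$\sum_{j=1}^p\mathbb E\big[|(R\Phi_\varepsilon)_j|^2\big]\le 2(\varepsilon+p).$$ -/

import Mathlib

open MeasureTheory ProbabilityTheory Filter Topology
open scoped NNReal ENNReal

noncomputable section

/-! ### Feedforward neural networks -/

/-- A neural network with input dimension `d` and output dimension `s`: a nonempty finite sequence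
`((W¹, b¹), …, (W^L, b^L))` of matrix-vector pairs of compatible dimensions. `output W b` is a
network with the single pair `(W, b)`, and `layer W b Φ` puts the pair `(W, b)` in front of `Φ`. -/
inductive NeuralNetwork : ℕ → ℕ → Type
  | output {d s : ℕ} (W : Matrix (Fin s) (Fin d) ℝ) (b : Fin s → ℝ) : NeuralNetwork d s
  | layer {d n s : ℕ} (W : Matrix (Fin n) (Fin d) ℝ) (b : Fin n → ℝ) (Φ : NeuralNetwork n s) :
      NeuralNetwork d s

namespace NeuralNetwork

/-- The realisation `A_L ∘ σ ∘ A_{L-1} ∘ ⋯ ∘ σ ∘ A_1` of a network, where `A_ℓ x = W^ℓ x + b^ℓ`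
and the activation function `σ` acts on every coordinate. -/
def realisation (σ : ℝ → ℝ) : {d s : ℕ} → NeuralNetwork d s → (Fin d → ℝ) → (Fin s → ℝ)
  | _, _, output W b, x => W.mulVec x + b
  | _, _, layer W b Φ, x => realisation σ Φ (fun i => σ ((W.mulVec x + b) i))

/-- The depth: the number `L` of layers. -/
def depth : {d s : ℕ} → NeuralNetwork d s → ℕ
  | _, _, output _ _ => 1
  | _, _, layer _ _ Φ => depth Φ + 1

/-- The number of nonzero entries of one matrix-vector pair. -/
def layerSize {d s : ℕ} (W : Matrix (Fin s) (Fin d) ℝ) (b : Fin s → ℝ) : ℕ :=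
  (Finset.univ.filter fun e : Fin s × Fin d => W e.1 e.2 ≠ 0).card +
    (Finset.univ.filter fun i : Fin s => b i ≠ 0).card

/-- The size `‖Φ‖₀`: the total number of nonzero weights (entries of the matrices and of the
vectors). -/
def size : {d s : ℕ} → NeuralNetwork d s → ℕ
  | _, _, output W b => layerSize W b
  | _, _, layer W b Φ => layerSize W b + size Φ

end NeuralNetwork

/-- The rectified linear unit. -/
def ReLU (x : ℝ) : ℝ := max x 0

/-! ### Brownian motion and the Wiener integral on `[0, T]` -/

/-- `W` is a (standard, real) Brownian motion on the time interval `[0, T]`: its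
finite-dimensional laws at times in `[0, T]` are centred Gaussian with covariance `min s t`, and
its paths are almost surely continuous on `[0, T]`. The values of `W` at times after `T` play no
role. -/
structure IsBrownianMotionOn {Ω : Type*} [MeasurableSpace Ω] (T : ℝ≥0) (W : ℝ≥0 → Ω → ℝ)
    (P : Measure Ω) : Prop where
  hasLaw : ∀ I : Finset ℝ≥0, (∀ t ∈ I, t ≤ T) →
    HasLaw (fun ω => I.restrict (fun t => W t ω)) (BrownianReal.projectiveFamily I) P
  cont : ∀ᵐ ω ∂P, ContinuousOn (fun t => W t ω) (Set.Iic T)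

/-- A step function `∑ᵢ cᵢ 1_{(aᵢ, bᵢ]}` on `[0, T]`, with `0 ≤ aᵢ ≤ bᵢ ≤ T`. -/
structure StepFunction (T : ℝ≥0) where
  n : ℕ
  c : Fin n → ℝ
  a : Fin n → ℝ≥0
  b : Fin n → ℝ≥0
  a_le_b : ∀ i, a i ≤ b i
  b_le : ∀ i, b i ≤ T

namespace StepFunction

variable {T : ℝ≥0}

/-- The function `t ↦ ∑ᵢ cᵢ 1_{(aᵢ, bᵢ]}(t)`. -/
def toFun (S : StepFunction T) (t : ℝ) : ℝ :=
  ∑ i, (Set.Ioc (S.a i : ℝ) (S.b i : ℝ)).indicator (fun _ => S.c i) t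

/-- The stochastic integral `∑ᵢ cᵢ (W_{bᵢ} - W_{aᵢ})` of a step function. -/
def stochIntegral {Ω : Type*} (S : StepFunction T) (W : ℝ≥0 → Ω → ℝ) (ω : Ω) : ℝ :=
  ∑ i, S.c i * (W (S.b i) ω - W (S.a i) ω)

end StepFunction

/-- `L²([0, T])`. -/
abbrev L2Time (T : ℝ≥0) : Type := Lp ℝ 2 ((volume : Measure ℝ).restrict (Set.Icc 0 (T : ℝ)))

/-- `Y` is (a version of) the Wiener integral `∫₀ᵀ h(s) dW_s` of `h ∈ L²([0, T])`: the
`L²(P)`-limit of the stochastic integrals of step functions that converge to `h` in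
`L²([0, T])`. -/
def IsWienerIntegral {Ω : Type*} [MeasurableSpace Ω] {T : ℝ≥0} (W : ℝ≥0 → Ω → ℝ) (P : Measure Ω)
    (h : L2Time T) (Y : Ω → ℝ) : Prop :=
  MemLp Y 2 P ∧ ∃ S : ℕ → StepFunction T,
    Tendsto (fun n => eLpNorm (fun t => h t - (S n).toFun t) 2
      ((volume : Measure ℝ).restrict (Set.Icc 0 (T : ℝ)))) atTop (𝓝 0) ∧
    Tendsto (fun n => eLpNorm (fun ω => Y ω - (S n).stochIntegral W ω) 2 P) atTop (𝓝 0)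

/-! ### Polynomial chaos -/

/-- The normalised Hermite polynomial
`H_n(x) = ((-1)^n / √(n!)) exp(x²/2) (dⁿ/dxⁿ) exp(-x²/2)`. -/
def hermiteH (n : ℕ) (x : ℝ) : ℝ :=
  (-1) ^ n / √(n.factorial : ℝ) * Real.exp (x ^ 2 / 2) *
    iteratedDeriv n (fun y : ℝ => Real.exp (-(y ^ 2 / 2))) x

/-- The polynomial chaos `Ψ_α = ∏ᵢ H_{αᵢ}(Gᵢ)` of a finitely supported multi-index `α`. The
factors with `αᵢ = 0` are equal to `1`. -/
def chaosPoly {Ω : Type*} (G : ℕ → Ω → ℝ) (α : ℕ →₀ ℕ) (ω : Ω) : ℝ :=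
  ∏ i ∈ α.support, hermiteH (α i) (G i ω)

/-- The order `|α| = ∑ᵢ αᵢ` of a multi-index, as a real number. -/
def multiOrder (α : ℕ →₀ ℕ) : ℝ := ((∑ i ∈ α.support, α i : ℕ) : ℝ)

/-- The number `|α|₀` of nonzero entries of a multi-index, as a real number. -/
def multiSupp (α : ℕ →₀ ℕ) : ℝ := (α.support.card : ℝ)

end

noncomputable section

/-! ### Hermite polynomials and the standard Gaussian measure -/

/-! Wiener integrals of an orthonormal system are independent standard Gaussians
(`IsWienerIntegral.hasLaw_pi`), because every finite linear combination is again a Wiener integral,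
with characteristic function determined by its `L²` norm. The task is thus to approximate
`hermiteProd` in `L²` of the standard Gaussian measure on `ℝᵐ`, each of the `p` outputs to accuracy
`δ = ε / p`.

Let `N` be the largest order, at least `1`. Hermite polynomials have only real roots
(`realHermite_splits`), bounded in modulus by the degree, so a chaos polynomial is a constant in
`[0, 1]` times a product of at most `N` factors `xᵢ - a` with `|a| ≤ N` (`hermiteProd_eq_prod`).
Clamping the inputs to `[-R, R]` and dividing by `R + N` puts every factor in `[-1, 1]`. A balanced
binary tree of approximate multiplications (`exists_isHiddenState_prod`) forms the product, where
`uv = ((u + v) / 2)² - ((u - v) / 2)²` and squares come from `K` sawtooth compositions, with error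
at most `4 ^ -(K + 1)`.

The output layer undoes the scaling. On the cube of active coordinates this magnifies the tree error
by at most `(R + N) ^ N`; off the cube polynomial growth loses against `exp (-R)` times a Gaussian
exponential moment (`sq_sub_le_of_clamped_approx`). With `R = 11 N² + log δ⁻¹` and `K` of order `N
log (1 + N) log δ⁻¹`, the tree has depth of order `K log (1 + N)` and size of order `p N K`. These
bounds contain no support factor and only `N²` in the size; the stated ones follow by evaluating the
suprema at an index of maximal order, whose support is nonempty.

The moment bound uses `E Ψ² = 1` and `r² ≤ 2 (Ψ - r)² + 2 Ψ²`. -/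

open Polynomial in
theorem Polynomial.derivative_hermite_succ (n : ℕ) :
    derivative (hermite (n + 1)) = (n + 1 : ℤ[X]) * hermite n := by
  induction n with
  | zero => simp [hermite_succ]
  | succ n ih =>
    rw [hermite_succ (n + 1), derivative_sub, derivative_mul, derivative_X, ih, derivative_mul,
      hermite_succ n]
    have h : derivative ((n : ℤ[X]) + 1) = 0 := by simp
    rw [h]
    push_cast
    ring

/-- The probabilists' Hermite polynomial with real coefficients. -/
def realHermite (n : ℕ) : Polynomial ℝ := (Polynomial.hermite n).map (Int.castRingHom ℝ)

section HermitePolynomials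

open Polynomial

theorem realHermite_zero : realHermite 0 = 1 := by simp [realHermite]

theorem realHermite_succ (n : ℕ) :
    realHermite (n + 1) = X * realHermite n - derivative (realHermite n) := by
  simp [realHermite, hermite_succ, derivative_map]

theorem realHermite_monic (n : ℕ) : (realHermite n).Monic :=
  (hermite_monic n).map _

theorem natDegree_realHermite (n : ℕ) : (realHermite n).natDegree = n := by
  rw [realHermite, (hermite_monic n).natDegree_map, natDegree_hermite]

theorem realHermite_succ_succ (n : ℕ) :
    realHermite (n + 2) = X * realHermite (n + 1) - (n + 1 : ℝ[X]) * realHermite n := by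
  rw [realHermite_succ (n + 1)]
  congr 1
  rw [realHermite, derivative_map, derivative_hermite_succ]
  simp [realHermite]

theorem hermiteH_eq_eval (n : ℕ) (x : ℝ) :
    hermiteH n x = (√(n.factorial : ℝ))⁻¹ * (realHermite n).eval x := by
  have h : (realHermite n).eval x = aeval x (hermite n) := by
    rw [realHermite, eval_map, aeval_def]; rfl
  rw [h, hermite_eq_deriv_gaussian', hermiteH, iteratedDeriv_eq_iterate]
  ring

theorem hermiteH_zero (x : ℝ) : hermiteH 0 x = 1 := by
  simp [hermiteH_eq_eval, realHermite_zero]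

theorem integrable_polynomial_gaussianReal (p : ℝ[X]) :
    Integrable (fun x => p.eval x) (gaussianReal 0 1) := by
  induction p using Polynomial.induction_on' with
  | add p q hp hq =>
    simp only [eval_add]
    exact hp.add hq
  | monomial n a =>
    simp only [eval_monomial]
    refine Integrable.const_mul ?_ a
    rcases eq_or_ne n 0 with rfl | hn
    · simp
    · have h : MemLp id (n : ℝ≥0∞) (gaussianReal 0 1) := by
        simpa using memLp_id_gaussianReal (μ := 0) (v := 1) (n : ℝ≥0)
      refine (integrable_norm_iff (by fun_prop)).1 ?_
      simpa using h.integrable_norm_pow hn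

theorem integrable_polynomial_mul_gaussianPDFReal (p : ℝ[X]) :
    Integrable (fun x => p.eval x * gaussianPDFReal 0 1 x) := by
  have h := integrable_polynomial_gaussianReal p
  rw [gaussianReal_of_var_ne_zero _ one_ne_zero, integrable_withDensity_iff_integrable_smul'
    (measurable_gaussianPDF 0 1) (ae_of_all _ fun x => gaussianPDF_lt_top)] at h
  simpa [mul_comm] using h

theorem hasDerivAt_gaussianPDFReal (x : ℝ) :
    HasDerivAt (gaussianPDFReal 0 1) (-x * gaussianPDFReal 0 1 x) x := by
  have h : gaussianPDFReal 0 1 = fun x => (√(2 * Real.pi))⁻¹ * Real.exp (-x ^ 2 / 2) := by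
    ext x; simp [gaussianPDFReal]
  rw [h]
  have h1 : HasDerivAt (fun x : ℝ => -x ^ 2 / 2) (-x) x := by
    have := ((hasDerivAt_pow 2 x).neg).div_const 2
    refine this.congr_deriv ?_
    simp
    ring
  refine ((h1.exp).const_mul _).congr_deriv ?_
  ring

/-- Gaussian integration by parts for polynomials. -/
theorem integral_X_mul_gaussianReal (p : ℝ[X]) :
    ∫ x, x * p.eval x ∂gaussianReal 0 1 = ∫ x, (derivative p).eval x ∂gaussianReal 0 1 := by
  have hderiv : ∀ x, HasDerivAt (fun x => p.eval x * gaussianPDFReal 0 1 x)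
      ((derivative p - X * p).eval x * gaussianPDFReal 0 1 x) x := by
    intro x
    refine ((p.hasDerivAt x).mul (hasDerivAt_gaussianPDFReal x)).congr_deriv ?_
    simp
    ring
  have h0 := integral_eq_zero_of_hasDerivAt_of_integrable hderiv
    (integrable_polynomial_mul_gaussianPDFReal _) (integrable_polynomial_mul_gaussianPDFReal _)
  have h1 : ∫ x, (derivative p - X * p).eval x ∂gaussianReal 0 1 = 0 := by
    rw [integral_gaussianReal_eq_integral_smul one_ne_zero]
    simpa [mul_comm] using h0
  simp only [eval_sub, eval_mul, eval_X] at h1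
  rw [integral_sub (integrable_polynomial_gaussianReal _)
    ((integrable_polynomial_gaussianReal (X * p)).congr (ae_of_all _ fun x => by simp))] at h1
  linarith

/-- The operator `X - d/dx` that raises the Hermite index is the Gaussian adjoint of `d/dx`, so each
index moves one derivative onto `q`. This yields both the normalisation and the orthogonality to
lower degrees. -/
theorem integral_realHermite_mul (n : ℕ) (q : ℝ[X]) :
    ∫ x, (realHermite n * q).eval x ∂gaussianReal 0 1 =
      ∫ x, (derivative^[n] q).eval x ∂gaussianReal 0 1 := by
  induction n generalizing q with
  | zero => simp [realHermite_zero]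
  | succ n ih =>
    have h1 := integral_X_mul_gaussianReal (realHermite n * q)
    rw [Function.iterate_succ_apply, ← ih]
    have h2 : realHermite (n + 1) * q =
        X * (realHermite n * q) - derivative (realHermite n) * q := by
      rw [realHermite_succ]; ring
    rw [h2]
    simp only [eval_sub]
    rw [integral_sub (integrable_polynomial_gaussianReal _) (integrable_polynomial_gaussianReal _)]
    simp only [eval_mul, eval_X] at h1 ⊢
    rw [h1, derivative_mul]
    simp only [eval_add, eval_mul]
    rw [integral_add]
    · ring
    · simpa using integrable_polynomial_gaussianReal (derivative (realHermite n) * q)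
    · simpa using integrable_polynomial_gaussianReal (realHermite n * derivative q)

theorem integral_realHermite_sq (n : ℕ) :
    ∫ x, (realHermite n).eval x ^ 2 ∂gaussianReal 0 1 = n.factorial := by
  have h := integral_realHermite_mul n (realHermite n)
  have h2 : derivative^[n] (realHermite n) = C (n.factorial : ℝ) := by
    have hdeg : (derivative^[n] (realHermite n)).natDegree = 0 := by
      have := natDegree_iterate_derivative (realHermite n) n
      rw [natDegree_realHermite] at this
      omega
    rw [eq_C_of_natDegree_eq_zero hdeg, coeff_iterate_derivative]
    have hm := (realHermite_monic n).coeff_natDegree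
    rw [natDegree_realHermite] at hm
    simp [hm, Nat.descFactorial_self]
  rw [h2] at h
  simpa [sq] using h

theorem integrable_hermiteH_sq (n : ℕ) :
    Integrable (fun x => hermiteH n x ^ 2) (gaussianReal 0 1) := by
  simp only [hermiteH_eq_eval, mul_pow]
  exact ((integrable_polynomial_gaussianReal (realHermite n ^ 2)).congr
    (ae_of_all _ fun x => by simp)).const_mul _

theorem integral_hermiteH_sq (n : ℕ) :
    ∫ x, hermiteH n x ^ 2 ∂gaussianReal 0 1 = 1 := by
  simp only [hermiteH_eq_eval, mul_pow]
  rw [integral_const_mul, integral_realHermite_sq, inv_pow,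
    Real.sq_sqrt (Nat.cast_nonneg _), inv_mul_cancel₀ (by positivity)]

/-- A nonreal root would give a factorisation `r * q` with `r` a strictly positive quadratic and
`deg q < n`. Orthogonality to `q` then says that `r * q ^ 2` has Gaussian integral zero, which
forces `q = 0`. -/
theorem realHermite_splits (n : ℕ) : (realHermite n).Splits := by
  refine Splits.of_splits_map_of_injective (algebraMap ℝ ℂ).injective
    (IsAlgClosed.splits _) fun z hz => ?_
  by_cases him : z.im = 0
  · exact ⟨z.re, Complex.ext (by simp) (by simp [him])⟩
  exfalso
  have hroot : aeval z (realHermite n) = 0 := by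
    have := (mem_roots'.1 hz).2
    rwa [IsRoot.def, eval_map_algebraMap] at this
  obtain ⟨q, hq⟩ := quadratic_dvd_of_aeval_eq_zero_im_ne_zero _ hroot him
  set r : ℝ[X] := X ^ 2 - C (2 * z.re) * X + C (‖z‖ ^ 2) with hr
  have hrpos : ∀ x : ℝ, 0 < r.eval x := by
    intro x
    have h1 : r.eval x = (x - z.re) ^ 2 + z.im ^ 2 := by
      simp only [hr, eval_add, eval_sub, eval_mul, eval_pow, eval_X, eval_C,
        ← Complex.normSq_eq_norm_sq, Complex.normSq_apply]
      ring
    rw [h1]; positivity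
  have hne : realHermite n ≠ 0 := (realHermite_monic n).ne_zero
  have hq0 : q ≠ 0 := by rintro rfl; exact hne (by simpa using hq)
  have hr0 : r ≠ 0 := by intro h; rw [h] at hq; exact hne (by simpa using hq)
  have hrdeg : r.natDegree = 2 := by
    rw [hr]; compute_degree!
  have hdeg : q.natDegree < n := by
    have := natDegree_mul hr0 hq0
    rw [← hq, natDegree_realHermite] at this
    omega
  have h0 := integral_realHermite_mul n q
  rw [iterate_derivative_eq_zero hdeg, hq] at h0
  simp only [eval_zero, integral_zero] at h0
  have hint := integrable_polynomial_gaussianReal (r * q * q)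
  have hnonneg : ∀ x, 0 ≤ (r * q * q).eval x := by
    intro x
    rw [mul_assoc, eval_mul, eval_mul]
    exact mul_nonneg (hrpos x).le (mul_self_nonneg _)
  rw [integral_eq_zero_iff_of_nonneg hnonneg hint] at h0
  have h1 : (fun x => (r * q * q).eval x) =ᵐ[volume] 0 :=
    (gaussianReal_absolutelyContinuous' 0 one_ne_zero).ae_le h0
  have h2 : (fun x => (r * q * q).eval x) = 0 :=
    (Continuous.ae_eq_iff_eq volume (by fun_prop) continuous_const).1 h1
  have h3 : r * q * q = 0 := Polynomial.funext fun x => by simpa using congrFun h2 x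
  exact mul_ne_zero (mul_ne_zero hr0 hq0) hq0 h3

/-- By the three-term recurrence, the absolute values at `x` increase with the index as long as the
index stays below `|x|`, starting from `1`. Hence all roots lie in `[-n, n]`. -/
theorem one_le_abs_eval_realHermite (n : ℕ) (x : ℝ) (hx : (n : ℝ) ≤ |x|) :
    1 ≤ |(realHermite n).eval x| := by
  have key : ∀ k : ℕ, ((k + 1 : ℕ) : ℝ) ≤ |x| →
      |(realHermite k).eval x| ≤ |(realHermite (k + 1)).eval x| := by
    intro k
    induction k with
    | zero => intro h; simpa [realHermite_succ, realHermite_zero] using h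
    | succ k ih =>
      intro h
      push_cast at h ih
      have ih' := ih (by linarith)
      have h1 : (realHermite (k + 2)).eval x =
          x * (realHermite (k + 1)).eval x - (k + 1) * (realHermite k).eval x := by
        simp [realHermite_succ_succ]
      have h2 := abs_sub_abs_le_abs_sub (x * (realHermite (k + 1)).eval x)
        ((k + 1) * (realHermite k).eval x)
      rw [← h1, abs_mul, abs_mul, abs_of_pos (by positivity : (0 : ℝ) < k + 1)] at h2
      have h3 : (k + 1) * |(realHermite k).eval x| ≤ (k + 1) * |(realHermite (k + 1)).eval x| :=
        mul_le_mul_of_nonneg_left ih' (by positivity)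
      nlinarith [abs_nonneg ((realHermite (k + 1)).eval x)]
  induction n with
  | zero => simp [realHermite_zero]
  | succ n ih =>
    exact (ih (le_trans (by simp) hx)).trans (key n hx)

theorem abs_le_of_mem_roots_realHermite {n : ℕ} {a : ℝ} (ha : a ∈ (realHermite n).roots) :
    |a| ≤ n := by
  by_contra! h
  have h1 := one_le_abs_eval_realHermite n a h.le
  rw [(mem_roots'.1 ha).2] at h1
  norm_num at h1

theorem hermiteH_eq_prod (n : ℕ) : ∃ l : List ℝ, l.length = n ∧ (∀ a ∈ l, |a| ≤ n) ∧
    ∀ x, hermiteH n x = (√(n.factorial : ℝ))⁻¹ * (l.map fun a => x - a).prod := by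
  refine ⟨(realHermite n).roots.toList, ?_, fun a ha => ?_, fun x => ?_⟩
  · rw [Multiset.length_toList, ← (realHermite_splits n).natDegree_eq_card_roots,
      natDegree_realHermite]
  · exact abs_le_of_mem_roots_realHermite (Multiset.mem_toList.1 ha)
  · rw [hermiteH_eq_eval, (realHermite_splits n).eval_eq_prod_roots_of_monic (realHermite_monic n)]
    congr 1
    rw [← Multiset.prod_coe, ← Multiset.map_coe, Multiset.coe_toList]

end HermitePolynomials

/-! ### The joint law of Wiener integrals of an orthonormal system -/

namespace IsBrownianMotionOn

variable {Ω : Type*} [MeasurableSpace Ω] {P : Measure Ω} {T : ℝ≥0} {W : ℝ≥0 → Ω → ℝ}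

theorem hasGaussianLaw_restrict (hW : IsBrownianMotionOn T W P) (I : Finset ℝ≥0)
    (hI : ∀ t ∈ I, t ≤ T) : HasGaussianLaw (fun ω => I.restrict (fun t => W t ω)) P :=
  (hW.hasLaw I hI).hasGaussianLaw

theorem hasGaussianLaw_eval (hW : IsBrownianMotionOn T W P) {t : ℝ≥0} (ht : t ≤ T) :
    HasGaussianLaw (W t) P :=
  (hW.hasGaussianLaw_restrict {t} (by simpa using ht)).eval ⟨t, by simp⟩

theorem integral_eval (hW : IsBrownianMotionOn T W P) {t : ℝ≥0} (ht : t ≤ T) :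
    ∫ ω, W t ω ∂P = 0 := by
  have h := (hW.hasLaw {t} (by simpa using ht)).integral_comp (f := fun x => x ⟨t, by simp⟩)
    (Measurable.aestronglyMeasurable (by fun_prop))
  rw [BrownianReal.integral_eval_projectiveFamily] at h
  exact h

theorem covariance_eval (hW : IsBrownianMotionOn T W P) {s t : ℝ≥0} (hs : s ≤ T) (ht : t ≤ T) :
    cov[W s, W t; P] = min s t := by
  have hI : ∀ r ∈ ({s, t} : Finset ℝ≥0), r ≤ T := by simp [hs, ht]
  have h := (hW.hasLaw {s, t} hI).covariance_fun_comp
    (f := Function.eval ⟨s, by simp⟩) (g := fun x => x ⟨t, by simp⟩)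
    (Measurable.aemeasurable (by fun_prop)) (Measurable.aemeasurable (by fun_prop))
  exact h.trans (BrownianReal.covariance_eval_projectiveFamily _ _ _)

/-- The overlap form lets the isometry be checked by expanding double sums, without making the
intervals of a step function disjoint. -/
theorem covariance_increment [IsProbabilityMeasure P] (hW : IsBrownianMotionOn T W P)
    {a b a' b' : ℝ≥0} (hab : a ≤ b) (hb : b ≤ T) (hab' : a' ≤ b') (hb' : b' ≤ T) :
    cov[fun ω => W b ω - W a ω, fun ω => W b' ω - W a' ω; P] =
      volume.real (Set.Ioc (a : ℝ) b ∩ Set.Ioc (a' : ℝ) b') := by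
  have hm : ∀ {t : ℝ≥0}, t ≤ T → MemLp (W t) 2 P := fun ht =>
    (hW.hasGaussianLaw_eval ht).memLp_two
  have ha := hab.trans hb
  have ha' := hab'.trans hb'
  rw [covariance_fun_sub_fun_sub (hm hb) (hm ha) (hm hb') (hm ha'), hW.covariance_eval hb hb',
    hW.covariance_eval hb ha', hW.covariance_eval ha hb', hW.covariance_eval ha ha',
    Set.Ioc_inter_Ioc, Real.volume_real_Ioc]
  have h1 : (a : ℝ) ≤ b := hab
  have h2 : (a' : ℝ) ≤ b' := hab'
  push_cast
  simp only [min_def, max_def]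
  split_ifs <;> linarith

end IsBrownianMotionOn

namespace StepFunction

section Algebra

variable {Ω : Type*} {T : ℝ≥0} {W : ℝ≥0 → Ω → ℝ}

/-- The concatenation of two step functions. -/
def add (S S' : StepFunction T) : StepFunction T where
  n := S.n + S'.n
  c := Fin.append S.c S'.c
  a := Fin.append S.a S'.a
  b := Fin.append S.b S'.b
  a_le_b := fun i => by
    refine Fin.addCases (fun i => ?_) (fun i => ?_) i
    · simpa using S.a_le_b i
    · simpa using S'.a_le_b i
  b_le := fun i => by
    refine Fin.addCases (fun i => ?_) (fun i => ?_) i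
    · simpa using S.b_le i
    · simpa using S'.b_le i

/-- A scalar multiple of a step function. -/
def smul (r : ℝ) (S : StepFunction T) : StepFunction T :=
  { S with c := fun i => r * S.c i }

/-- The step function without any steps. -/
def zero (T : ℝ≥0) : StepFunction T where
  n := 0
  c := Fin.elim0
  a := Fin.elim0
  b := Fin.elim0
  a_le_b := fun i => i.elim0
  b_le := fun i => i.elim0

theorem toFun_add (S S' : StepFunction T) (t : ℝ) :
    (S.add S').toFun t = S.toFun t + S'.toFun t := by
  refine (Fin.sum_univ_add _).trans ?_
  simp [toFun, add]

theorem toFun_smul (r : ℝ) (S : StepFunction T) (t : ℝ) :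
    (S.smul r).toFun t = r * S.toFun t := by
  simp only [toFun, Finset.mul_sum, ← Set.indicator_const_mul]
  rfl

theorem toFun_zero (t : ℝ) : (zero T).toFun t = 0 := by
  simp [toFun, zero]

theorem stochIntegral_add (S S' : StepFunction T) (ω : Ω) :
    (S.add S').stochIntegral W ω = S.stochIntegral W ω + S'.stochIntegral W ω := by
  refine (Fin.sum_univ_add _).trans ?_
  simp [stochIntegral, add]

theorem stochIntegral_smul (r : ℝ) (S : StepFunction T) (ω : Ω) :
    (S.smul r).stochIntegral W ω = r * S.stochIntegral W ω := by
  simp only [stochIntegral, Finset.mul_sum, ← mul_assoc]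
  rfl

theorem stochIntegral_zero (ω : Ω) : (zero T).stochIntegral W ω = 0 := by
  simp [stochIntegral, zero]

end Algebra

variable {Ω : Type*} [MeasurableSpace Ω] {P : Measure Ω} {T : ℝ≥0} {W : ℝ≥0 → Ω → ℝ}

theorem hasGaussianLaw_stochIntegral (S : StepFunction T) (hW : IsBrownianMotionOn T W P) :
    HasGaussianLaw (S.stochIntegral W) P := by
  classical
  let I : Finset ℝ≥0 := Finset.univ.image S.a ∪ Finset.univ.image S.b
  have hI : ∀ t ∈ I, t ≤ T := by
    intro t ht
    simp only [I, Finset.mem_union, Finset.mem_image, Finset.mem_univ, true_and] at ht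
    rcases ht with ⟨i, rfl⟩ | ⟨i, rfl⟩
    exacts [(S.a_le_b i).trans (S.b_le i), S.b_le i]
  have ha : ∀ i, S.a i ∈ I := fun i => by simp [I]
  have hb : ∀ i, S.b i ∈ I := fun i => by simp [I]
  let L : (I → ℝ) →L[ℝ] ℝ := ∑ i, S.c i •
    (ContinuousLinearMap.proj (R := ℝ) (φ := fun _ : I => ℝ) ⟨S.b i, hb i⟩ -
      ContinuousLinearMap.proj (R := ℝ) (φ := fun _ : I => ℝ) ⟨S.a i, ha i⟩)
  have h := (hW.hasGaussianLaw_restrict I hI).map L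
  have hL : L ∘ (fun ω => I.restrict (fun t => W t ω)) = S.stochIntegral W := by
    ext ω
    simp [L, stochIntegral]
  rwa [hL] at h

theorem memLp_toFun (S : StepFunction T) (p : ℝ≥0∞) :
    MemLp S.toFun p ((volume : Measure ℝ).restrict (Set.Icc 0 (T : ℝ))) := by
  have : S.toFun = fun t => ∑ i, (Set.Ioc (S.a i : ℝ) (S.b i : ℝ)).indicator (fun _ => S.c i) t :=
    rfl
  rw [this]
  exact memLp_finsetSum _ fun i _ => (memLp_const (S.c i)).indicator measurableSet_Ioc

theorem integral_stochIntegral (S : StepFunction T) (hW : IsBrownianMotionOn T W P) :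
    ∫ ω, S.stochIntegral W ω ∂P = 0 := by
  have hi : ∀ {t : ℝ≥0}, t ≤ T → Integrable (W t) P := fun ht =>
    (hW.hasGaussianLaw_eval ht).integrable
  unfold stochIntegral
  have hi2 : ∀ i, Integrable (fun ω => S.c i * (W (S.b i) ω - W (S.a i) ω)) P := fun i =>
    ((hi (S.b_le i)).sub (hi ((S.a_le_b i).trans (S.b_le i)))).const_mul _
  rw [integral_finsetSum _ fun i _ => hi2 i]
  refine Finset.sum_eq_zero fun i _ => ?_
  rw [integral_const_mul, integral_sub (hi (S.b_le i)) (hi ((S.a_le_b i).trans (S.b_le i))),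
    hW.integral_eval (S.b_le i), hW.integral_eval ((S.a_le_b i).trans (S.b_le i))]
  simp

/-- The Wiener isometry for step functions. -/
theorem variance_stochIntegral [IsProbabilityMeasure P] (S : StepFunction T)
    (hW : IsBrownianMotionOn T W P) :
    Var[S.stochIntegral W; P] = ∫ t in Set.Icc 0 (T : ℝ), S.toFun t ^ 2 := by
  have hm : ∀ {t : ℝ≥0}, t ≤ T → MemLp (W t) 2 P := fun ht =>
    (hW.hasGaussianLaw_eval ht).memLp_two
  have h1 : Var[S.stochIntegral W; P] = ∑ i, ∑ j, S.c i * S.c j *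
      volume.real (Set.Ioc (S.a i : ℝ) (S.b i) ∩ Set.Ioc (S.a j : ℝ) (S.b j)) := by
    have hm2 : ∀ i, MemLp (fun ω => S.c i * (W (S.b i) ω - W (S.a i) ω)) 2 P := fun i =>
      ((hm (S.b_le i)).sub (hm ((S.a_le_b i).trans (S.b_le i)))).const_mul (S.c i)
    unfold stochIntegral
    rw [variance_fun_sum hm2]
    refine Finset.sum_congr rfl fun i _ => Finset.sum_congr rfl fun j _ => ?_
    rw [covariance_const_mul_left, covariance_const_mul_right,
      hW.covariance_increment (S.a_le_b i) (S.b_le i) (S.a_le_b j) (S.b_le j)]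
    ring
  have h2 : ∀ t, S.toFun t ^ 2 = ∑ i, ∑ j,
      (Set.Ioc (S.a i : ℝ) (S.b i) ∩ Set.Ioc (S.a j : ℝ) (S.b j)).indicator
        (fun _ => S.c i * S.c j) t := by
    intro t
    rw [toFun, sq, Finset.sum_mul_sum]
    refine Finset.sum_congr rfl fun i _ => Finset.sum_congr rfl fun j _ => ?_
    rw [Set.inter_indicator_mul]
  have hint : ∀ i j, Integrable
      ((Set.Ioc (S.a i : ℝ) (S.b i) ∩ Set.Ioc (S.a j : ℝ) (S.b j)).indicator
        (fun _ => S.c i * S.c j)) ((volume : Measure ℝ).restrict (Set.Icc 0 (T : ℝ))) :=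
    fun i j => (integrable_const _).indicator (measurableSet_Ioc.inter measurableSet_Ioc)
  rw [h1]
  simp only [h2]
  rw [integral_finsetSum _ fun i _ => integrable_finsetSum _ fun j _ => hint i j]
  refine Finset.sum_congr rfl fun i _ => ?_
  rw [integral_finsetSum _ fun j _ => hint i j]
  refine Finset.sum_congr rfl fun j _ => ?_
  rw [setIntegral_indicator (measurableSet_Ioc.inter measurableSet_Ioc), setIntegral_const,
    smul_eq_mul, mul_comm]
  congr 2
  refine (Set.inter_eq_right.2 fun t ht => ?_).symm
  exact ⟨(NNReal.coe_nonneg _).trans ht.1.1.le, ht.1.2.trans (NNReal.coe_le_coe.2 (S.b_le i))⟩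

theorem integral_cexp_stochIntegral [IsProbabilityMeasure P] (S : StepFunction T)
    (hW : IsBrownianMotionOn T W P) :
    ∫ ω, Complex.exp (S.stochIntegral W ω * Complex.I) ∂P =
      Complex.exp (-((∫ t in Set.Icc 0 (T : ℝ), S.toFun t ^ 2 : ℝ) : ℂ) / 2) := by
  have hG := S.hasGaussianLaw_stochIntegral hW
  have h := charFun_gaussianReal (μ := P[S.stochIntegral W])
    (v := Var[S.stochIntegral W; P].toNNReal) 1
  rw [← hG.map_eq_gaussianReal, charFun_apply_real, integral_map hG.aemeasurable
    (by fun_prop), S.integral_stochIntegral hW, S.variance_stochIntegral hW] at h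
  simp only [Complex.ofReal_one, one_mul, Complex.ofReal_zero, zero_mul, zero_sub, one_pow,
    mul_one] at h
  rw [h, Real.coe_toNNReal _ (integral_nonneg fun t => sq_nonneg _), neg_div]

end StepFunction

namespace IsWienerIntegral

variable {Ω : Type*} [MeasurableSpace Ω] {P : Measure Ω} {T : ℝ≥0} {W : ℝ≥0 → Ω → ℝ}

theorem zero : IsWienerIntegral W P (0 : L2Time T) 0 := by
  refine ⟨MemLp.zero, fun _ => StepFunction.zero T, ?_, ?_⟩
  · have h : ∀ᵐ t ∂((volume : Measure ℝ).restrict (Set.Icc 0 (T : ℝ))),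
        (0 : L2Time T) t - (StepFunction.zero T).toFun t = 0 := by
      filter_upwards [Lp.coeFn_zero ℝ 2 ((volume : Measure ℝ).restrict (Set.Icc 0 (T : ℝ)))]
        with t ht
      rw [ht, StepFunction.toFun_zero]; simp
    have h' : ∀ n : ℕ, eLpNorm (fun t => (0 : L2Time T) t - (StepFunction.zero T).toFun t) 2
        ((volume : Measure ℝ).restrict (Set.Icc 0 (T : ℝ))) = 0 := fun _ => by
      rw [eLpNorm_congr_ae h]
      simp
    exact tendsto_const_nhds.congr fun n => (h' n).symm
  · simp [StepFunction.stochIntegral_zero]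

theorem add {h h' : L2Time T} {Y Y' : Ω → ℝ} (hW : IsBrownianMotionOn T W P)
    (H : IsWienerIntegral W P h Y) (H' : IsWienerIntegral W P h' Y') :
    IsWienerIntegral W P (h + h') (Y + Y') := by
  obtain ⟨hY, S, hS, hSW⟩ := H
  obtain ⟨hY', S', hS', hSW'⟩ := H'
  refine ⟨hY.add hY', fun n => (S n).add (S' n), ?_, ?_⟩
  · refine tendsto_of_tendsto_of_tendsto_of_le_of_le tendsto_const_nhds
      (by simpa using hS.add hS') (fun _ => zero_le) fun n => ?_
    refine le_trans (le_of_eq (eLpNorm_congr_ae ?_)) (eLpNorm_add_le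
      ((Lp.memLp h).sub ((S n).memLp_toFun 2)).1 ((Lp.memLp h').sub ((S' n).memLp_toFun 2)).1
      one_le_two)
    filter_upwards [Lp.coeFn_add h h'] with t ht
    rw [ht, StepFunction.toFun_add]
    simp only [Pi.add_apply]
    ring
  · refine tendsto_of_tendsto_of_tendsto_of_le_of_le tendsto_const_nhds
      (by simpa using hSW.add hSW') (fun _ => zero_le) fun n => ?_
    refine le_trans (le_of_eq (eLpNorm_congr_ae (ae_of_all _ fun ω => ?_))) (eLpNorm_add_le
      (hY.1.sub ((S n).hasGaussianLaw_stochIntegral hW).aemeasurable.aestronglyMeasurable)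
      (hY'.1.sub ((S' n).hasGaussianLaw_stochIntegral hW).aemeasurable.aestronglyMeasurable)
      one_le_two)
    simp only [StepFunction.stochIntegral_add, Pi.add_apply]
    ring

theorem smul {h : L2Time T} {Y : Ω → ℝ} (r : ℝ) (H : IsWienerIntegral W P h Y) :
    IsWienerIntegral W P (r • h) (r • Y) := by
  obtain ⟨hY, S, hS, hSW⟩ := H
  refine ⟨hY.const_smul r, fun n => (S n).smul r, ?_, ?_⟩
  · have h1 : ∀ n, eLpNorm (fun t => (r • h : L2Time T) t - ((S n).smul r).toFun t) 2
        ((volume : Measure ℝ).restrict (Set.Icc 0 (T : ℝ))) =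
        ‖r‖ₑ * eLpNorm (fun t => h t - (S n).toFun t) 2
        ((volume : Measure ℝ).restrict (Set.Icc 0 (T : ℝ))) := by
      intro n
      rw [← eLpNorm_const_smul]
      refine eLpNorm_congr_ae ?_
      filter_upwards [Lp.coeFn_smul r h] with t ht
      rw [ht, StepFunction.toFun_smul]
      simp only [Pi.smul_apply, smul_eq_mul]
      ring
    simp only [h1]
    simpa using ENNReal.Tendsto.const_mul hS (Or.inr (by simp))
  · have h1 : ∀ n, eLpNorm (fun ω => (r • Y) ω - ((S n).smul r).stochIntegral W ω) 2 P =
        ‖r‖ₑ * eLpNorm (fun ω => Y ω - (S n).stochIntegral W ω) 2 P := by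
      intro n
      rw [← eLpNorm_const_smul]
      congr 1
      ext ω
      simp only [StepFunction.stochIntegral_smul, Pi.smul_apply, smul_eq_mul]
      ring
    simp only [h1]
    simpa using ENNReal.Tendsto.const_mul hSW (Or.inr (by simp))

theorem sum {ι : Type*} (hW : IsBrownianMotionOn T W P) {h : ι → L2Time T} {Y : ι → Ω → ℝ}
    (s : Finset ι) (r : ι → ℝ) (H : ∀ i, IsWienerIntegral W P (h i) (Y i)) :
    IsWienerIntegral W P (∑ i ∈ s, r i • h i) (∑ i ∈ s, r i • Y i) := by
  classical
  induction s using Finset.induction_on with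
  | empty => simpa using zero
  | insert i s hi ih =>
    rw [Finset.sum_insert hi, Finset.sum_insert hi]
    exact add hW (smul _ (H i)) ih

/-- Step integrals converge almost surely along a subsequence, so the bounded exponentials converge
by dominated convergence, while the isometry turns the Gaussian exponents into `L²` norms. Frequency
`1` suffices, since Wiener integrals are linear in `h`. -/
theorem integral_cexp [IsProbabilityMeasure P] (hW : IsBrownianMotionOn T W P)
    {h : L2Time T} {Y : Ω → ℝ} (H : IsWienerIntegral W P h Y) :
    ∫ ω, Complex.exp (Y ω * Complex.I) ∂P = Complex.exp (-((‖h‖ ^ 2 : ℝ) : ℂ) / 2) := by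
  obtain ⟨hY, S, hS, hSW⟩ := H
  have hmeas : ∀ n, AEStronglyMeasurable ((S n).stochIntegral W) P := fun n =>
    ((S n).hasGaussianLaw_stochIntegral hW).aemeasurable.aestronglyMeasurable
  have hSW2 : Tendsto (fun n => eLpNorm ((S n).stochIntegral W - Y) 2 P) atTop (𝓝 0) := by
    refine hSW.congr fun n => ?_
    rw [eLpNorm_sub_comm]; rfl
  obtain ⟨ns, hns, hae⟩ := (tendstoInMeasure_of_tendsto_eLpNorm two_ne_zero hmeas hY.1
    hSW2).exists_seq_tendsto_ae
  have hlim1 : Tendsto (fun k => ∫ ω, Complex.exp ((S (ns k)).stochIntegral W ω * Complex.I) ∂P)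
      atTop (𝓝 (∫ ω, Complex.exp (Y ω * Complex.I) ∂P)) := by
    refine tendsto_integral_of_dominated_convergence (fun _ => 1) (fun k => ?_)
      (integrable_const _) (fun k => ae_of_all _ fun ω => ?_) ?_
    · have hc : Continuous fun x : ℝ => Complex.exp (x * Complex.I) := by fun_prop
      exact hc.comp_aestronglyMeasurable (hmeas _)
    · rw [Complex.norm_exp_ofReal_mul_I]
    · filter_upwards [hae] with ω hω
      have hc : Continuous fun x : ℝ => Complex.exp (x * Complex.I) := by fun_prop
      exact (hc.tendsto _).comp hω
  have hS2 : Tendsto (fun n => ((S n).memLp_toFun 2).toLp) atTop (𝓝 h) := by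
    rw [← Lp.toLp_coeFn h (Lp.memLp h), Lp.tendsto_Lp_iff_tendsto_eLpNorm'']
    refine hS.congr fun n => ?_
    rw [eLpNorm_sub_comm]; rfl
  have hnorm : ∀ n, ‖((S n).memLp_toFun 2).toLp‖ ^ 2 =
      ∫ t in Set.Icc 0 (T : ℝ), (S n).toFun t ^ 2 := by
    intro n
    rw [← real_inner_self_eq_norm_sq, L2.inner_def]
    refine integral_congr_ae ?_
    filter_upwards [((S n).memLp_toFun 2).coeFn_toLp] with t ht
    rw [ht]
    simp [sq]
  have hlim2 : Tendsto (fun k => ∫ ω, Complex.exp ((S (ns k)).stochIntegral W ω * Complex.I) ∂P)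
      atTop (𝓝 (Complex.exp (-((‖h‖ ^ 2 : ℝ) : ℂ) / 2))) := by
    simp only [StepFunction.integral_cexp_stochIntegral _ hW, ← hnorm]
    have hc : Continuous fun g : L2Time T => Complex.exp (-((‖g‖ ^ 2 : ℝ) : ℂ) / 2) := by
      fun_prop
    exact (hc.tendsto h).comp (hS2.comp hns.tendsto_atTop)
  exact tendsto_nhds_unique hlim1 hlim2

/-- The Wiener integrals of an orthonormal system are independent standard Gaussians. -/
theorem hasLaw_pi [IsProbabilityMeasure P] (hW : IsBrownianMotionOn T W P)
    {e : ℕ → L2Time T} (he : Orthonormal ℝ e) {G : ℕ → Ω → ℝ}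
    (hG : ∀ i, IsWienerIntegral W P (e i) (G i)) (m : ℕ) :
    HasLaw (fun ω (i : Fin m) => G i ω) (Measure.pi fun _ : Fin m => gaussianReal 0 1) P := by
  have hm : AEMeasurable (fun ω (i : Fin m) => G i ω) P :=
    aemeasurable_pi_lambda _ fun i => (hG i).1.1.aemeasurable
  refine ⟨hm, ?_⟩
  have := Measure.isProbabilityMeasure_map hm
  refine Measure.ext_of_charFunDual (funext fun L => ?_)
  have hL : ∀ x : Fin m → ℝ, L x = ∑ i, L (Pi.single i 1) * x i := by
    intro x
    conv_lhs => rw [← Finset.univ_sum_single x, map_sum]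
    refine Finset.sum_congr rfl fun i _ => ?_
    have : (Pi.single i (x i) : Fin m → ℝ) = x i • Pi.single i 1 := by
      rw [← Pi.single_smul, smul_eq_mul, mul_one]
    rw [this, map_smul, smul_eq_mul, mul_comm]
  rw [charFunDual_pi, charFunDual_apply, integral_map hm (by fun_prop)]
  -- A linear functional of the vector is the Wiener integral of the matching combination of the `e
  -- i`; orthonormality makes its squared norm a sum of squares, so the characteristic function
  -- factorises.
  have h1 := integral_cexp hW (sum hW Finset.univ (fun i : Fin m => L (Pi.single i 1))
    (fun i => hG (i : ℕ)))
  have h2 : ∀ ω, (∑ i : Fin m, L (Pi.single i 1) • G i) ω = L (fun i => G i ω) := by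
    intro ω
    rw [hL]
    simp
  simp only [h2] at h1
  rw [h1]
  have he' : Orthonormal ℝ (fun i : Fin m => e i) := he.comp _ Fin.val_injective
  rw [← real_inner_self_eq_norm_sq, he'.inner_sum]
  simp only [charFunDual_eq_charFun_map_one]
  have h3 : ∀ i : Fin m, charFun (Measure.map (L ∘SL ContinuousLinearMap.single ℝ (fun _ => ℝ) i)
      (gaussianReal 0 1)) 1 =
      Complex.exp (-((L (Pi.single i 1) * L (Pi.single i 1) : ℝ) : ℂ) / 2) := by
    intro i
    rw [gaussianReal_map_continuousLinearMap, charFun_gaussianReal]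
    simp [sq]
    rw [max_eq_left (mul_self_nonneg _)]
    push_cast
    ring_nf
  rw [Finset.prod_congr rfl fun i _ => h3 i, ← Complex.exp_sum]
  congr 1
  push_cast
  simp [neg_div, Finset.sum_div]

end IsWienerIntegral

/-! ### Sparse ReLU layers -/

theorem ReLU_of_nonneg {x : ℝ} (hx : 0 ≤ x) : ReLU x = x := max_eq_left hx

theorem ReLU_nonneg (x : ℝ) : 0 ≤ ReLU x := le_max_right _ _

theorem ReLU_sub_ReLU_neg (x : ℝ) : ReLU x - ReLU (-x) = x := by
  unfold ReLU
  rcases le_total 0 x with h | h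
  · rw [max_eq_left h, max_eq_right (by linarith)]; ring
  · rw [max_eq_right h, max_eq_left (by linarith)]; ring

theorem ReLU_add_ReLU_neg (x : ℝ) : ReLU x + ReLU (-x) = |x| := by
  unfold ReLU
  rcases le_total 0 x with h | h
  · rw [max_eq_left h, max_eq_right (by linarith), abs_of_nonneg h]; ring
  · rw [max_eq_right h, max_eq_left (by linarith), abs_of_nonpos h]; ring

/-- The matrix whose row `k` has the entries `w k i` in the columns `src k i`. -/
def sparseMatrix {d s c : ℕ} (src : Fin s → Fin c → Fin d) (w : Fin s → Fin c → ℝ) :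
    Matrix (Fin s) (Fin d) ℝ :=
  fun k j => ∑ i, if src k i = j then w k i else 0

theorem sparseMatrix_mulVec {d s c : ℕ} (src : Fin s → Fin c → Fin d) (w : Fin s → Fin c → ℝ)
    (x : Fin d → ℝ) (k : Fin s) :
    (sparseMatrix src w).mulVec x k = ∑ i, w k i * x (src k i) := by
  simp only [Matrix.mulVec, dotProduct, sparseMatrix, Finset.sum_mul]
  rw [Finset.sum_comm]
  simp

/-- Each row is supported on at most `c` columns, and the bias adds one entry. The bound is
independent of the width `d`, which keeps the size linear in the number of neurons. -/
theorem layerSize_sparseMatrix_le {d s c : ℕ} (src : Fin s → Fin c → Fin d)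
    (w : Fin s → Fin c → ℝ) (b : Fin s → ℝ) :
    NeuralNetwork.layerSize (sparseMatrix src w) b ≤ s * (c + 1) := by
  have h1 : (Finset.univ.filter fun e : Fin s × Fin d => sparseMatrix src w e.1 e.2 ≠ 0).card ≤
      s * c := by
    have hsub : (Finset.univ.filter fun e : Fin s × Fin d => sparseMatrix src w e.1 e.2 ≠ 0) ⊆
        (Finset.univ : Finset (Fin s × Fin c)).image fun e => (e.1, src e.1 e.2) := by
      rintro ⟨k, j⟩ h
      obtain ⟨i, -, hi⟩ := Finset.exists_ne_zero_of_sum_ne_zero (Finset.mem_filter.1 h).2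
      simp only [Finset.mem_image, Finset.mem_univ, true_and, Prod.exists]
      refine ⟨k, i, ?_⟩
      by_contra hne
      exact hi (if_neg fun heq => hne (Prod.ext rfl heq))
    refine (Finset.card_le_card hsub).trans (Finset.card_image_le.trans ?_)
    simp
  have h2 : (Finset.univ.filter fun i : Fin s => b i ≠ 0).card ≤ s :=
    (Finset.card_filter_le _ _).trans (by simp)
  unfold NeuralNetwork.layerSize
  calc _ ≤ s * c + s := add_le_add h1 h2
    _ = s * (c + 1) := by ring

/-- `g` is the vector of post-activation values of a hidden layer of a ReLU network: every network
`Ψ` that reads `g x` can be preceded by `D` layers with at most `S` nonzero weights. -/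
def IsHiddenState {m : ℕ} {κ : Type} (D S : ℕ) (g : (Fin m → ℝ) → κ → ℝ) : Prop :=
  ∀ (w s : ℕ) (e : κ ≃ Fin w) (Ψ : NeuralNetwork w s), ∃ Φ : NeuralNetwork m s,
    Φ.depth = D + Ψ.depth ∧ Φ.size ≤ S + Ψ.size ∧
    ∀ x, Φ.realisation ReLU x = Ψ.realisation ReLU (fun i => g x (e.symm i))

theorem isHiddenState_input {m c : ℕ} {κ : Type} [Fintype κ] (src : κ → Fin c → Fin m)
    (w : κ → Fin c → ℝ) (b : κ → ℝ) :
    IsHiddenState 1 (Fintype.card κ * (c + 1))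
      (fun (x : Fin m → ℝ) k => ReLU (∑ i, w k i * x (src k i) + b k)) := by
  intro n s e Ψ
  have hn : Fintype.card κ = n := by simpa using Fintype.card_congr e
  refine ⟨.layer (sparseMatrix (fun k => src (e.symm k)) fun k => w (e.symm k))
    (fun k => b (e.symm k)) Ψ, ?_, ?_, fun x => ?_⟩
  · simp [NeuralNetwork.depth, add_comm]
  · rw [NeuralNetwork.size, hn]
    exact Nat.add_le_add_right (layerSize_sparseMatrix_le _ _ _) _
  · simp only [NeuralNetwork.realisation, Pi.add_apply, sparseMatrix_mulVec]

namespace IsHiddenState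


variable {m c D S : ℕ} {κ κ' : Type} {g : (Fin m → ℝ) → κ → ℝ}

theorem congr {D' S' : ℕ} {g' : (Fin m → ℝ) → κ → ℝ} (hg : IsHiddenState D S g) (hD : D = D')
    (hS : S = S') (h : ∀ x k, g x k = g' x k) : IsHiddenState D' S' g' := by
  obtain rfl : g = g' := funext fun x => funext (h x)
  subst hD hS
  exact hg

variable [Fintype κ] [Fintype κ']

theorem layer (hg : IsHiddenState D S g) (src : κ' → Fin c → κ) (w : κ' → Fin c → ℝ)
    (b : κ' → ℝ) :
    IsHiddenState (D + 1) (S + Fintype.card κ' * (c + 1))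
      (fun x k => ReLU (∑ i, w k i * g x (src k i) + b k)) := by
  intro n s e Ψ
  have hn : Fintype.card κ' = n := by simpa using Fintype.card_congr e
  obtain ⟨Φ, hd, hs, hr⟩ := hg _ s (Fintype.equivFin κ)
    (.layer (sparseMatrix (fun k i => Fintype.equivFin κ (src (e.symm k) i))
      fun k => w (e.symm k)) (fun k => b (e.symm k)) Ψ)
  refine ⟨Φ, ?_, ?_, fun x => ?_⟩
  · rw [hd, NeuralNetwork.depth]; ring
  · rw [NeuralNetwork.size] at hs
    have := layerSize_sparseMatrix_le (fun k i => Fintype.equivFin κ (src (e.symm k) i))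
      (fun k => w (e.symm k)) (fun k => b (e.symm k))
    rw [hn]
    omega
  · rw [hr]
    simp only [NeuralNetwork.realisation, Pi.add_apply, sparseMatrix_mulVec,
      Equiv.symm_apply_apply]

theorem output {p : ℕ} (hg : IsHiddenState D S g) (src : Fin p → Fin c → κ)
    (w : Fin p → Fin c → ℝ) :
    ∃ Φ : NeuralNetwork m p, Φ.depth = D + 1 ∧ Φ.size ≤ S + p * (c + 1) ∧
      ∀ x j, Φ.realisation ReLU x j = ∑ i, w j i * g x (src j i) := by
  obtain ⟨Φ, hd, hs, hr⟩ := hg _ p (Fintype.equivFin κ)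
    (.output (sparseMatrix (fun k i => Fintype.equivFin κ (src k i)) w) 0)
  refine ⟨Φ, by rw [hd, NeuralNetwork.depth], hs.trans ?_, fun x j => ?_⟩
  · exact Nat.add_le_add_left (layerSize_sparseMatrix_le _ _ _) _
  · rw [hr]
    simp only [NeuralNetwork.realisation, Pi.add_apply, sparseMatrix_mulVec,
      Equiv.symm_apply_apply, Pi.zero_apply, add_zero]


end IsHiddenState

/-! ### Approximate squaring with sawtooth functions -/

/-- The `k`-fold composition of the hat function on `[0, 1]`. -/
def sawtooth : ℕ → ℝ → ℝ
  | 0, a => a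
  | k + 1, a => 2 * sawtooth k a - 4 * ReLU (sawtooth k a - 1 / 2)

/-- The piecewise linear interpolation of `a ↦ a ^ 2` on `[0, 1]` at the multiples of `2⁻ᵏ`. -/
def sqApprox : ℕ → ℝ → ℝ
  | 0, a => a
  | k + 1, a => sqApprox k a - sawtooth (k + 1) a / 4 ^ (k + 1)

theorem sawtooth_mem {a : ℝ} (ha : a ∈ Set.Icc (0 : ℝ) 1) (k : ℕ) :
    sawtooth k a ∈ Set.Icc (0 : ℝ) 1 := by
  induction k with
  | zero => exact ha
  | succ k ih =>
    obtain ⟨h0, h1⟩ := ih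
    simp only [sawtooth, ReLU]
    rcases le_total (sawtooth k a) (1 / 2) with h | h
    · rw [max_eq_right (by linarith)]; constructor <;> linarith
    · rw [max_eq_left (by linarith)]; constructor <;> linarith

/-- If `t` is the hat function at `s`, then `(s - s²) - t / 4 = (t - t²) / 4` on either branch, so
the error keeps its form and gains a factor `1 / 4` at each step. -/
theorem sqApprox_sub_sq (k : ℕ) (a : ℝ) :
    sqApprox k a - a ^ 2 = (sawtooth k a - sawtooth k a ^ 2) / 4 ^ k := by
  induction k with
  | zero => simp [sqApprox, sawtooth]
  | succ k ih =>
    have h : sqApprox (k + 1) a - a ^ 2 =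
        (sqApprox k a - a ^ 2) - sawtooth (k + 1) a / 4 ^ (k + 1) := by
      simp only [sqApprox]; ring
    rw [h, ih]
    simp only [sawtooth, ReLU]
    rcases le_total (sawtooth k a) (1 / 2) with h | h
    · rw [max_eq_right (by linarith)]; field_simp; ring
    · rw [max_eq_left (by linarith)]; field_simp; ring

theorem sq_le_sqApprox {a : ℝ} (ha : a ∈ Set.Icc (0 : ℝ) 1) (k : ℕ) : a ^ 2 ≤ sqApprox k a := by
  obtain ⟨h0, h1⟩ := sawtooth_mem ha k
  have h : 0 ≤ (sawtooth k a - sawtooth k a ^ 2) / 4 ^ k :=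
    div_nonneg (by nlinarith) (by positivity)
  linarith [sqApprox_sub_sq k a]

theorem sqApprox_le_sq_add {a : ℝ} (k : ℕ) : sqApprox k a ≤ a ^ 2 + (1 / 4) ^ (k + 1) := by
  have h : (sawtooth k a - sawtooth k a ^ 2) / 4 ^ k ≤ (1 / 4) / 4 ^ k := by
    gcongr
    nlinarith [sq_nonneg (sawtooth k a - 1 / 2)]
  have h2 : (1 / 4 : ℝ) / 4 ^ k = (1 / 4) ^ (k + 1) := by
    rw [pow_succ, one_div_pow]; ring
  linarith [sqApprox_sub_sq k a]

theorem sqApprox_mem {a : ℝ} (ha : a ∈ Set.Icc (0 : ℝ) 1) (k : ℕ) :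
    sqApprox k a ∈ Set.Icc (0 : ℝ) 1 := by
  refine ⟨(sq_nonneg a).trans (sq_le_sqApprox ha k), ?_⟩
  induction k with
  | zero => exact ha.2
  | succ k ih =>
    have := (sawtooth_mem ha (k + 1)).1
    simp only [sqApprox] at ih ⊢
    have : 0 ≤ sawtooth (k + 1) a / 4 ^ (k + 1) := by positivity
    linarith

namespace IsHiddenState

variable {m D S : ℕ}

/-- Three neurons per value suffice: the sawtooth, its kink, and the running square. The stored
quantities are nonnegative, so the activation preserves them. Three rows of at most `3 + 1` entries
give the `12`. -/
theorem sawtooth_iterate {I : Type} [Fintype I] {a : (Fin m → ℝ) → I → ℝ}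
    (ha : ∀ x i, a x i ∈ Set.Icc (0 : ℝ) 1) (K : ℕ)
    (hg : IsHiddenState D S (fun x (i : I × Fin 3) =>
      ![a x i.1, ReLU (a x i.1 - 1 / 2), a x i.1] i.2)) :
    IsHiddenState (D + K) (S + K * (Fintype.card I * 12)) (fun x (i : I × Fin 3) =>
      ![sawtooth K (a x i.1), ReLU (sawtooth K (a x i.1) - 1 / 2), sqApprox K (a x i.1)] i.2) := by
  induction K with
  | zero => simpa [sawtooth, sqApprox] using hg
  | succ K ih =>
    have h := ih.layer (κ' := I × Fin 3) (c := 3) (fun i c => (i.1, c))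
      (fun i => ![![2, -4, 0], ![2, -4, 0], ![-2 / 4 ^ (K + 1), 4 / 4 ^ (K + 1), 1]] i.2)
      (fun i => ![0, -1 / 2, 0] i.2)
    refine h.congr (add_assoc _ _ _) ?_ fun x i => ?_
    · simp; ring
    · obtain ⟨i, r⟩ := i
      have h1 := (sawtooth_mem (ha x i) (K + 1)).1
      have h2 := (sqApprox_mem (ha x i) (K + 1)).1
      fin_cases r
      · simp [Fin.sum_univ_three]
        rw [eq_comm, ← ReLU_of_nonneg h1]
        congr 1
        simp only [sawtooth]; ring_nf
      · simp [Fin.sum_univ_three]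
        congr 1
        simp only [sawtooth]; ring_nf
      · simp [Fin.sum_univ_three]
        rw [eq_comm, ← ReLU_of_nonneg h2]
        congr 1
        simp only [sqApprox, sawtooth]; ring_nf

/-- Approximate squares of the halved absolute sums and differences of two signed values, each
of which is stored as a difference of two nonnegative numbers. -/
theorem mul_level {J : Type} [Fintype J] {z : (Fin m → ℝ) → (J × Bool) × Bool → ℝ}
    (hz : ∀ x i, z x i ∈ Set.Icc (0 : ℝ) 1) (hg : IsHiddenState D S z) (K : ℕ) :
    IsHiddenState (D + (K + 3)) (S + Fintype.card J * (24 * K + 42))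
      (fun x (i : J × Bool) => sqApprox K
        |((z x ((i.1, true), true) - z x ((i.1, true), false)) + (if i.2 then 1 else -1) *
          (z x ((i.1, false), true) - z x ((i.1, false), false))) / 2|) := by
  set v : (Fin m → ℝ) → J × Bool → ℝ := fun x i =>
    ((z x ((i.1, true), true) - z x ((i.1, true), false)) + (if i.2 then 1 else -1) *
      (z x ((i.1, false), true) - z x ((i.1, false), false))) / 2 with hv
  have ha : ∀ x i, |v x i| ∈ Set.Icc (0 : ℝ) 1 := by
    intro x i
    refine ⟨abs_nonneg _, abs_le.2 ?_⟩
    have h1 := hz x ((i.1, true), true)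
    have h2 := hz x ((i.1, true), false)
    have h3 := hz x ((i.1, false), true)
    have h4 := hz x ((i.1, false), false)
    simp only [Set.mem_Icc] at h1 h2 h3 h4
    simp only [hv]
    split_ifs <;> constructor <;> linarith
  have h1 := hg.layer (κ' := (J × Bool) × Bool) (c := 4)
    (fun i => ![((i.1.1, true), true), ((i.1.1, true), false), ((i.1.1, false), true),
      ((i.1.1, false), false)])
    (fun i c => (if i.2 then 1 else -1) / 2 *
      ![1, -1, if i.1.2 then 1 else -1, -(if i.1.2 then 1 else -1)] c) (fun _ => 0)
  have e1 : (fun x (i : (J × Bool) × Bool) => ReLU (∑ c : Fin 4, (if i.2 then 1 else -1) / 2 *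
      ![1, -1, if i.1.2 then 1 else -1, -(if i.1.2 then 1 else -1)] c *
      z x ((![((i.1.1, true), true), ((i.1.1, true), false), ((i.1.1, false), true),
      ((i.1.1, false), false)] : Fin 4 → (J × Bool) × Bool) c) + 0)) =
      fun x i => ReLU ((if i.2 then 1 else -1) * v x i.1) := by
    funext x ⟨⟨j, s⟩, t⟩
    congr 1
    simp only [Fin.sum_univ_four, hv]
    rcases s <;> rcases t <;> simp <;> ring_nf
  rw [e1] at h1
  -- The previous layer holds `ReLU (v)` and `ReLU (-v)`, whose sum is `|v|`; this layer sets up the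
  -- initial sawtooth state.
  have h2 := h1.layer (κ' := (J × Bool) × Fin 3) (c := 2)
    (fun i => ![(i.1, true), (i.1, false)]) (fun i => ![1, 1]) (fun i => ![0, -1 / 2, 0] i.2)
  have e2 : (fun x (i : (J × Bool) × Fin 3) => ReLU (∑ c : Fin 2, (![1, 1] : Fin 2 → ℝ) c *
      ReLU ((if (![(i.1, true), (i.1, false)] c : (J × Bool) × Bool).2 then 1 else -1) *
        v x (![(i.1, true), (i.1, false)] c : (J × Bool) × Bool).1) +
      (![0, -1 / 2, 0] : Fin 3 → ℝ) i.2)) =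
      fun x i => ![|v x i.1|, ReLU (|v x i.1| - 1 / 2), |v x i.1|] i.2 := by
    funext x i
    obtain ⟨i, r⟩ := i
    have h := ReLU_add_ReLU_neg (v x i)
    fin_cases r <;> simp [Fin.sum_univ_two, h, ReLU_of_nonneg]
    ring_nf
  rw [e2] at h2
  have h3 := h2.sawtooth_iterate ha K
  have h4 := h3.layer (κ' := J × Bool) (c := 1) (fun i _ => (i, 2)) (fun _ _ => 1) (fun _ => 0)
  refine h4.congr (by ring) ?_ fun x i => ?_
  -- Per `j`, the two initial layers and the final selection cost `20 + 18 + 4 = 42`, and each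
  -- sawtooth step costs `24`.
  · simp
    ring
  · simp only [Fin.sum_univ_one, one_mul, add_zero]
    exact ReLU_of_nonneg (sqApprox_mem (ha x i) K).1

end IsHiddenState

/-- Both squares are approximated from above, so their errors partly cancel and the difference costs
only one error unit. -/
theorem abs_sqApprox_sub_sqApprox_sub_mul_le {u v : ℝ} (hu : |u| ≤ 1) (hv : |v| ≤ 1) (K : ℕ) :
    |sqApprox K |(u + v) / 2| - sqApprox K |(u - v) / 2| - u * v| ≤ (1 / 4) ^ (K + 1) := by
  rw [abs_le] at hu hv
  have ha : |(u + v) / 2| ∈ Set.Icc (0 : ℝ) 1 :=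
    ⟨abs_nonneg _, abs_le.2 ⟨by linarith, by linarith⟩⟩
  have hb : |(u - v) / 2| ∈ Set.Icc (0 : ℝ) 1 :=
    ⟨abs_nonneg _, abs_le.2 ⟨by linarith, by linarith⟩⟩
  have h1 := sq_le_sqApprox ha K
  have h2 := sq_le_sqApprox hb K
  have h3 := sqApprox_le_sq_add (a := |(u + v) / 2|) K
  have h4 := sqApprox_le_sq_add (a := |(u - v) / 2|) K
  have h5 : |(u + v) / 2| ^ 2 - |(u - v) / 2| ^ 2 = u * v := by
    rw [sq_abs, sq_abs]; ring
  rw [abs_le]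
  constructor <;> linarith

/-! ### Products of clamped affine functions -/

/-- The projection to the interval `[-R, R]`. -/
def clamp (R x : ℝ) : ℝ := ReLU (x + R) - ReLU (x - R) - R

theorem clamp_eq_self {R x : ℝ} (hx : |x| ≤ R) : clamp R x = x := by
  rw [abs_le] at hx
  unfold clamp ReLU
  rw [max_eq_left (by linarith), max_eq_right (by linarith)]
  ring

theorem abs_clamp_le {R : ℝ} (hR : 0 ≤ R) (x : ℝ) : |clamp R x| ≤ R := by
  unfold clamp ReLU
  rw [abs_le]
  rcases le_total (x + R) 0 with h | h <;> rcases le_total (x - R) 0 with h' | h' <;>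
    simp only [max_eq_left, max_eq_right, h, h'] <;> constructor <;> linarith

/-- The affine function `x ↦ α * clamp R (x i) + β` that is encoded by `(i, α, β)`. -/
def clampedAffine {m : ℕ} (R : ℝ) (x : Fin m → ℝ) (f : Fin m × ℝ × ℝ) : ℝ :=
  f.2.1 * clamp R (x f.1) + f.2.2

theorem List.abs_prod_le_one {l : List ℝ} (h : ∀ a ∈ l, |a| ≤ 1) : |l.prod| ≤ 1 := by
  induction l with
  | nil => simp
  | cons a l ih =>
    rw [List.prod_cons, abs_mul]
    exact mul_le_one₀ (h a (by simp)) (abs_nonneg _) (ih fun b hb => h b (by simp [hb]))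

/-- The first layer produces the two kinks of the clamp, the second the positive and negative parts
of the affine value; they cost `4` and `6` weights per factor. -/
theorem isHiddenState_clampedAffine {m : ℕ} {J : Type} [Fintype J] (R : ℝ)
    (f : J → Fin m × ℝ × ℝ) :
    IsHiddenState 2 (Fintype.card J * 10) (fun (x : Fin m → ℝ) (i : J × Bool) =>
      ReLU ((if i.2 then 1 else -1) * clampedAffine R x (f i.1))) := by
  have h1 := isHiddenState_input (m := m) (κ := J × Bool) (c := 1) (fun i _ => (f i.1).1)
    (fun _ _ => 1) (fun i => (if i.2 then 1 else -1) * R)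
  have h2 := h1.layer (κ' := J × Bool) (c := 2) (fun i => ![(i.1, true), (i.1, false)])
    (fun i => ![(if i.2 then 1 else -1) * (f i.1).2.1, -((if i.2 then 1 else -1) * (f i.1).2.1)])
    (fun i => (if i.2 then 1 else -1) * ((f i.1).2.2 - (f i.1).2.1 * R))
  refine h2.congr rfl ?_ fun x i => ?_
  · simp; ring
  · obtain ⟨j, s⟩ := i
    congr 1
    rcases s <;> simp [clampedAffine, clamp, Fin.sum_univ_two] <;> ring_nf

/-- Binary tree of products: each list is split into two halves, so `J` must vary in the induction
and is replaced by `J × Bool`. The cost of one further level is included on the left of the size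
bound to make the induction close. The error obeys `E ↦ 2 * E + (1 / 4) ^ (K + 1)`. -/
theorem exists_isHiddenState_prod {m : ℕ} (hm : 0 < m) {R : ℝ} (K q : ℕ) :
    ∀ (J : Type) [Fintype J] (l : J → List (Fin m × ℝ × ℝ)), (∀ j, (l j).length ≤ 2 ^ q) →
    (∀ j, ∀ f ∈ l j, ∀ x, |clampedAffine R x f| ≤ 1) →
    ∃ (S : ℕ) (z : (Fin m → ℝ) → J × Bool → ℝ),
      S + Fintype.card J * (24 * K + 42) ≤ Fintype.card J * 2 ^ q * (24 * K + 52) ∧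
      IsHiddenState (2 + q * (K + 3)) S z ∧ (∀ x i, z x i ∈ Set.Icc (0 : ℝ) 1) ∧
      ∀ x j, |z x (j, true) - z x (j, false) - ((l j).map (clampedAffine R x)).prod| ≤
        (2 ^ q - 1) * (1 / 4) ^ (K + 1) := by
  induction q with
  | zero =>
    intro J _ l hl hf
    -- An empty list is represented by the constant factor `1`, with slope `0` at an arbitrary
    -- coordinate.
    let f : J → Fin m × ℝ × ℝ := fun j => (l j).headD (⟨0, hm⟩, 0, 1)
    have hprod : ∀ x j, ((l j).map (clampedAffine R x)).prod = clampedAffine R x (f j) := by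
      intro x j
      have hlen := hl j
      simp only [f]
      generalize l j = lj at hlen
      rcases lj with _ | ⟨a, _ | ⟨b, t⟩⟩
      · simp [clampedAffine]
      · simp
      · simp at hlen
    have hle : ∀ x j, |clampedAffine R x (f j)| ≤ 1 := by
      intro x j
      rw [← hprod]
      refine List.abs_prod_le_one fun a ha => ?_
      obtain ⟨b, hb, rfl⟩ := List.mem_map.1 ha
      exact hf j b hb x
    refine ⟨_, _, ?_, by simpa using isHiddenState_clampedAffine R f, fun x i => ?_, fun x j => ?_⟩
    · apply le_of_eq; ring
    · refine ⟨ReLU_nonneg _, max_le ?_ zero_le_one⟩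
      have := abs_le.1 (hle x i.1)
      split_ifs <;> linarith
    · rw [hprod]
      have := ReLU_sub_ReLU_neg (clampedAffine R x (f j))
      simp [this]
  | succ q ih =>
    intro J _ l hl hf
    obtain ⟨S, z, hS, hz, hmem, herr⟩ := ih (J × Bool)
      (fun i => if i.2 then (l i.1).take (2 ^ q) else (l i.1).drop (2 ^ q))
      (by
        rintro ⟨j, b⟩
        have := hl j
        rw [pow_succ] at this
        rcases b with _ | _
        · simp; omega
        · simp)
      (by
        rintro ⟨j, b⟩ f hfm
        refine hf j f ?_
        rcases b with _ | _
        · exact List.mem_of_mem_drop (by simpa using hfm)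
        · exact List.mem_of_mem_take (by simpa using hfm))
    have hlevel := (hz.mul_level hmem K).congr (D' := 2 + (q + 1) * (K + 3)) (by ring) rfl
      fun _ _ => rfl
    refine ⟨_, _, ?_, hlevel, ?_, ?_⟩
    · simp at hS
      rw [pow_succ]
      nlinarith
    · intro x i
      refine sqApprox_mem ⟨abs_nonneg _, abs_le.2 ?_⟩ K
      have h1 := hmem x ((i.1, true), true)
      have h2 := hmem x ((i.1, true), false)
      have h3 := hmem x ((i.1, false), true)
      have h4 := hmem x ((i.1, false), false)
      simp only [Set.mem_Icc] at h1 h2 h3 h4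
      split_ifs <;> constructor <;> linarith
    · intro x j
      have ht := herr x (j, true)
      have hu := herr x (j, false)
      have h1 := hmem x ((j, true), true)
      have h2 := hmem x ((j, true), false)
      have h3 := hmem x ((j, false), true)
      have h4 := hmem x ((j, false), false)
      simp only [Set.mem_Icc, if_true, Bool.false_eq_true, if_false] at ht hu h1 h2 h3 h4 ⊢
      set u := z x ((j, true), true) - z x ((j, true), false)
      set v := z x ((j, false), true) - z x ((j, false), false)
      have hu1 : |u| ≤ 1 := abs_le.2 ⟨by linarith, by linarith⟩
      have hv1 : |v| ≤ 1 := abs_le.2 ⟨by linarith, by linarith⟩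
      have hprod : ((l j).map (clampedAffine R x)).prod =
          (((l j).take (2 ^ q)).map (clampedAffine R x)).prod *
            (((l j).drop (2 ^ q)).map (clampedAffine R x)).prod := by
        rw [← List.prod_append, ← List.map_append, List.take_append_drop]
      have hq1 : |(((l j).take (2 ^ q)).map (clampedAffine R x)).prod| ≤ 1 := by
        refine List.abs_prod_le_one fun a ha => ?_
        obtain ⟨b, hb, rfl⟩ := List.mem_map.1 ha
        exact hf j b (List.mem_of_mem_take hb) x
      have hmul := abs_sqApprox_sub_sqApprox_sub_mul_le hu1 hv1 K
      rw [hprod, one_mul, neg_one_mul, ← sub_eq_add_neg]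
      set p := (((l j).take (2 ^ q)).map (clampedAffine R x)).prod
      set r := (((l j).drop (2 ^ q)).map (clampedAffine R x)).prod
      set E := ((2 : ℝ) ^ q - 1) * (1 / 4) ^ (K + 1) with hE
      -- Uses `u * v - p * r = v * (u - p) + p * (v - r)` with `|v| ≤ 1` and `|p| ≤ 1`.
      have h5 : |v * (u - p)| ≤ E := by
        rw [abs_mul]
        exact (mul_le_of_le_one_left (abs_nonneg _) hv1).trans ht
      have h6 : |p * (v - r)| ≤ E := by
        rw [abs_mul]
        exact (mul_le_of_le_one_left (abs_nonneg _) hq1).trans hu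
      have h7 : ((2 : ℝ) ^ (q + 1) - 1) * (1 / 4) ^ (K + 1) = (1 / 4) ^ (K + 1) + E + E := by
        rw [hE, pow_succ]; ring
      rw [h7]
      rw [abs_le] at hmul h5 h6 ⊢
      constructor <;> nlinarith

/-! ### Products of Hermite polynomials under the standard Gaussian measure -/

/-- The standard Gaussian measure on `ℝᵐ`. -/
abbrev stdGaussianPi (m : ℕ) : Measure (Fin m → ℝ) := Measure.pi fun _ => gaussianReal 0 1

/-- The product `∏ᵢ H_{αᵢ}(xᵢ)`. -/
def hermiteProd {m : ℕ} (α : Fin m → ℕ) (x : Fin m → ℝ) : ℝ := ∏ i, hermiteH (α i) (x i)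

theorem continuous_hermiteH (n : ℕ) : Continuous (hermiteH n) := by
  have : hermiteH n = fun x => (√(n.factorial : ℝ))⁻¹ * (realHermite n).eval x :=
    funext (hermiteH_eq_eval n)
  rw [this]
  fun_prop

theorem continuous_hermiteProd {m : ℕ} (α : Fin m → ℕ) : Continuous (hermiteProd α) :=
  continuous_finsetProd _ fun i _ => (continuous_hermiteH (α i)).comp (continuous_apply i)

theorem integrable_hermiteProd_sq {m : ℕ} (α : Fin m → ℕ) :
    Integrable (fun x => hermiteProd α x ^ 2) (stdGaussianPi m) := by
  simp only [hermiteProd, ← Finset.prod_pow]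
  exact Integrable.fintype_prod (f := fun i x => hermiteH (α i) x ^ 2)
    fun i => integrable_hermiteH_sq (α i)

theorem integral_hermiteProd_sq {m : ℕ} (α : Fin m → ℕ) :
    ∫ x, hermiteProd α x ^ 2 ∂stdGaussianPi m = 1 := by
  simp only [hermiteProd, ← Finset.prod_pow]
  rw [integral_fintype_prod_eq_prod (fun i x => hermiteH (α i) x ^ 2)]
  simp [integral_hermiteH_sq]

/-- The constant is the product of the `(√(αᵢ!))⁻¹`, hence at most `1`. Recording that only
coordinates with `αᵢ ≠ 0` occur keeps the truncation error independent of `m`. -/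
theorem hermiteProd_eq_prod {m : ℕ} (α : Fin m → ℕ) :
    ∃ (l : List (Fin m × ℝ)) (c : ℝ), 0 ≤ c ∧ c ≤ 1 ∧ l.length = ∑ i, α i ∧
      (∀ f ∈ l, α f.1 ≠ 0 ∧ |f.2| ≤ ∑ i, α i) ∧
      ∀ x, hermiteProd α x = c * (l.map fun f => x f.1 - f.2).prod := by
  have key : ∀ s : Finset (Fin m), ∃ (l : List (Fin m × ℝ)) (c : ℝ), 0 ≤ c ∧ c ≤ 1 ∧
      l.length = ∑ i ∈ s, α i ∧ (∀ f ∈ l, α f.1 ≠ 0 ∧ |f.2| ≤ α f.1) ∧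
      ∀ x : Fin m → ℝ, ∏ i ∈ s, hermiteH (α i) (x i) =
        c * (l.map fun f => x f.1 - f.2).prod := by
    intro s
    induction s using Finset.induction_on with
    | empty => exact ⟨[], 1, by simp⟩
    | insert i s hi ih =>
      obtain ⟨l, c, hc0, hc1, hlen, hl, hx⟩ := ih
      obtain ⟨r, hrlen, hr, hrx⟩ := hermiteH_eq_prod (α i)
      have hd : (1 : ℝ) ≤ √((α i).factorial : ℝ) :=
        Real.one_le_sqrt.2 (by exact_mod_cast Nat.one_le_iff_ne_zero.2 (Nat.factorial_ne_zero _))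
      refine ⟨(r.map fun a => (i, a)) ++ l, (√((α i).factorial : ℝ))⁻¹ * c, by positivity,
        mul_le_one₀ (inv_le_one_of_one_le₀ hd) hc0 hc1, ?_, ?_, fun x => ?_⟩
      · simp [Finset.sum_insert hi, hrlen, hlen]
      · intro f hf
        rcases List.mem_append.1 hf with hf | hf
        · obtain ⟨a, ha, rfl⟩ := List.mem_map.1 hf
          refine ⟨?_, hr a ha⟩
          rw [← hrlen]
          exact (List.length_pos_of_mem ha).ne'
        · exact hl f hf
      · rw [Finset.prod_insert hi, hx, hrx]
        simp only [List.map_append, List.map_map, List.prod_append]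
        rw [show ((fun f : Fin m × ℝ => x f.1 - f.2) ∘ fun a => (i, a)) = fun a => x i - a from rfl]
        ring
  obtain ⟨l, c, hc0, hc1, hlen, hl, hx⟩ := key Finset.univ
  refine ⟨l, c, hc0, hc1, hlen, fun f hf => ⟨(hl f hf).1, (hl f hf).2.trans ?_⟩, hx⟩
  exact_mod_cast Finset.single_le_sum (f := α) (fun _ _ => Nat.zero_le _) (Finset.mem_univ f.1)

theorem integrable_exp_two_mul_abs_gaussianReal :
    Integrable (fun x => Real.exp (2 * |x|)) (gaussianReal 0 1) := by
  refine ((integrable_exp_mul_gaussianReal 2).add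
    (integrable_exp_mul_gaussianReal (-2))).mono' (by fun_prop) (ae_of_all _ fun x => ?_)
  rw [Real.norm_of_nonneg (Real.exp_pos _).le]
  simp only [Pi.add_apply]
  rcases abs_cases x with ⟨h, -⟩ | ⟨h, -⟩ <;> rw [h]
  · linarith [Real.exp_pos (-2 * x)]
  · rw [mul_neg, ← neg_mul]; linarith [Real.exp_pos (2 * x)]

/-- Bounding by `exp (2x) + exp (-2x)` gives `2 * exp 2`, which is at most `exp 3`. -/
theorem integral_exp_two_mul_abs_gaussianReal_le :
    ∫ x, Real.exp (2 * |x|) ∂gaussianReal 0 1 ≤ Real.exp 3 := by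
  have hmgf : ∀ t : ℝ, ∫ x, Real.exp (t * x) ∂gaussianReal 0 1 = Real.exp (t ^ 2 / 2) := by
    intro t
    have := congrFun (mgf_fun_id_gaussianReal (μ := 0) (v := 1)) t
    simpa [mgf] using this
  have h1 : ∫ x, Real.exp (2 * |x|) ∂gaussianReal 0 1 ≤
      ∫ x, (Real.exp (2 * x) + Real.exp (-2 * x)) ∂gaussianReal 0 1 := by
    refine integral_mono integrable_exp_two_mul_abs_gaussianReal
      ((integrable_exp_mul_gaussianReal 2).add (integrable_exp_mul_gaussianReal (-2))) fun x => ?_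
    rcases abs_cases x with ⟨h, -⟩ | ⟨h, -⟩ <;> simp only [h]
    · linarith [Real.exp_pos (-2 * x)]
    · rw [mul_neg, ← neg_mul]; linarith [Real.exp_pos (2 * x)]
  rw [integral_add (integrable_exp_mul_gaussianReal 2) (integrable_exp_mul_gaussianReal (-2)),
    hmgf, hmgf] at h1
  have h2 : Real.exp 3 = Real.exp 1 * Real.exp 2 := by rw [← Real.exp_add]; norm_num
  have h3 : (2 : ℝ) ≤ Real.exp 1 := by have := Real.add_one_le_exp 1; linarith
  norm_num at h1
  rw [h2]
  nlinarith [Real.exp_pos 2]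

theorem exp_two_mul_sum_abs_eq {m : ℕ} (s : Finset (Fin m)) (x : Fin m → ℝ) :
    Real.exp (2 * ∑ i ∈ s, |x i|) = ∏ i, if i ∈ s then Real.exp (2 * |x i|) else 1 := by
  rw [Finset.mul_sum, Real.exp_sum, Finset.prod_ite_mem, Finset.univ_inter]

theorem integrable_exp_two_mul_sum_abs {m : ℕ} (s : Finset (Fin m)) :
    Integrable (fun x => Real.exp (2 * ∑ i ∈ s, |x i|)) (stdGaussianPi m) := by
  simp only [exp_two_mul_sum_abs_eq]
  refine Integrable.fintype_prod (f := fun i x => if i ∈ s then Real.exp (2 * |x|) else 1)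
    fun i => ?_
  split_ifs
  · exact integrable_exp_two_mul_abs_gaussianReal
  · exact integrable_const _

theorem integral_exp_two_mul_sum_abs_le {m : ℕ} (s : Finset (Fin m)) :
    ∫ x, Real.exp (2 * ∑ i ∈ s, |x i|) ∂stdGaussianPi m ≤ Real.exp (3 * s.card) := by
  simp only [exp_two_mul_sum_abs_eq]
  rw [integral_fintype_prod_eq_prod (fun i x => if i ∈ s then Real.exp (2 * |x|) else 1)]
  have h : ∀ i, ∫ x, (if i ∈ s then Real.exp (2 * |x|) else 1) ∂gaussianReal 0 1 =
      if i ∈ s then ∫ x, Real.exp (2 * |x|) ∂gaussianReal 0 1 else 1 := by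
    intro i
    split_ifs <;> simp
  rw [Finset.prod_congr rfl fun i _ => h i, Finset.prod_ite_mem, Finset.univ_inter,
    Finset.prod_const]
  refine (pow_le_pow_left₀ (integral_nonneg fun x => (Real.exp_pos _).le)
    integral_exp_two_mul_abs_gaussianReal_le _).trans (le_of_eq ?_)
  rw [← Real.exp_nat_mul, mul_comm]

/-! ### The truncation error -/

theorem List.abs_prod_le_pow {l : List ℝ} {B : ℝ} (h : ∀ a ∈ l, |a| ≤ B) :
    |l.prod| ≤ B ^ l.length := by
  induction l with
  | nil => simp
  | cons a l ih =>
    rw [List.prod_cons, abs_mul, List.length_cons, pow_succ']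
    have ha := h a (by simp)
    exact mul_le_mul ha (ih fun b hb => h b (by simp [hb])) (abs_nonneg _)
      ((abs_nonneg a).trans ha)

/-- Outside of the cube `[-R, R]ᵐ`, polynomial growth is dominated by an exponential. -/
theorem pow_le_factorial_mul_exp {N : ℕ} {R Y : ℝ} (hY : 0 ≤ Y) (hRY : R ≤ Y) :
    (Y + N) ^ (2 * N) ≤ (2 * N).factorial * Real.exp (N - R) * Real.exp (2 * Y) := by
  have h1 := Real.pow_div_factorial_le_exp (Y + N) (by positivity) (2 * N)
  rw [div_le_iff₀ (by positivity)] at h1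
  refine h1.trans ?_
  -- Since `R ≤ Y`, one extra factor `exp Y` pays for the small factor `exp (-R)`.
  have h2 : Real.exp (Y + N) ≤ Real.exp (N - R) * Real.exp (2 * Y) := by
    rw [← Real.exp_add]
    exact Real.exp_le_exp.2 (by linarith)
  rw [mul_assoc, mul_comm (Real.exp _)]
  gcongr

/-- The pointwise error of a truncated approximate product. -/
theorem sq_sub_le_of_clamped_approx {m N : ℕ} (hN : 1 ≤ N) {R η : ℝ} (hR : 0 ≤ R)
    {l : List (Fin m × ℝ)} {c : ℝ} (hc0 : 0 ≤ c) (hc1 : c ≤ 1) (hlen : l.length ≤ N)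
    {s : Finset (Fin m)} (hl : ∀ f ∈ l, f.1 ∈ s ∧ |f.2| ≤ N) {x : Fin m → ℝ} {v : ℝ}
    (hv1 : |v| ≤ 1)
    (hv : |v - ((l.map fun f => (f.1, (R + N)⁻¹, -f.2 / (R + N))).map
      (clampedAffine R x)).prod| ≤ η) :
    (c * (l.map fun f => x f.1 - f.2).prod - c * (R + N) ^ l.length * v) ^ 2 ≤
      ((R + N) ^ N * η) ^ 2 +
        4 * ((2 * N).factorial * Real.exp (N - R)) * Real.exp (2 * ∑ i ∈ s, |x i|) := by
  have hN' : (1 : ℝ) ≤ N := by exact_mod_cast hN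
  have hM : (1 : ℝ) ≤ R + N := by linarith
  have hMn : (R + N) ^ l.length ≤ (R + N) ^ N := pow_le_pow_right₀ hM hlen
  have hE : 0 ≤ 4 * ((2 * N).factorial * Real.exp (N - R)) * Real.exp (2 * ∑ i ∈ s, |x i|) := by
    positivity
  -- Inside the cube of active coordinates the clamp does nothing and only the tree error remains.
  -- Outside, target and network are each at most `(Y + N) ^ N` with `Y ≥ R`.
  by_cases hx : ∀ i ∈ s, |x i| ≤ R
  · have hprod : (l.map fun f => x f.1 - f.2).prod = (R + N) ^ l.length *
        ((l.map fun f => (f.1, (R + N)⁻¹, -f.2 / (R + N))).map (clampedAffine R x)).prod := by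
      have hl' : ∀ f ∈ l, |x f.1| ≤ R := fun f hf => hx _ (hl f hf).1
      clear hv hlen hMn hl
      induction l with
      | nil => simp
      | cons f l ih =>
        simp only [List.map_cons, List.prod_cons, List.length_cons]
        rw [ih fun g hg => hl' g (by simp [hg])]
        have : clampedAffine R x (f.1, (R + N)⁻¹, -f.2 / (R + N)) = (x f.1 - f.2) / (R + N) := by
          simp only [clampedAffine, clamp_eq_self (hl' f (by simp))]
          ring
        rw [this, pow_succ]
        field_simp
    rw [hprod]
    set p := ((l.map fun f => (f.1, (R + N)⁻¹, -f.2 / (R + N))).map (clampedAffine R x)).prod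
    have h1 : c * ((R + N) ^ l.length * p) - c * (R + N) ^ l.length * v =
        -(c * (R + N) ^ l.length * (v - p)) := by ring
    rw [h1, neg_sq]
    have h2 : |c * (R + N) ^ l.length * (v - p)| ≤ (R + N) ^ N * η := by
      rw [abs_mul, abs_mul, abs_of_nonneg hc0, abs_of_nonneg (by positivity)]
      have h3 : c * (R + N) ^ l.length ≤ (R + N) ^ N :=
        (mul_le_of_le_one_left (by positivity) hc1).trans hMn
      exact mul_le_mul h3 hv (abs_nonneg _) (by positivity)
    have h4 := sq_le_sq' (abs_le.1 h2).1 (abs_le.1 h2).2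
    linarith
  · push Not at hx
    obtain ⟨i, his, hi⟩ := hx
    set Y := ∑ i ∈ s, |x i| with hY
    have hle : ∀ j ∈ s, |x j| ≤ Y := fun j hj =>
      Finset.single_le_sum (f := fun i => |x i|) (fun _ _ => abs_nonneg _) hj
    have hRY : R ≤ Y := hi.le.trans (hle i his)
    have hY0 : 0 ≤ Y := hR.trans hRY
    have h1 : |c * (l.map fun f => x f.1 - f.2).prod| ≤ (Y + N) ^ N := by
      rw [abs_mul, abs_of_nonneg hc0]
      refine (mul_le_of_le_one_left (abs_nonneg _) hc1).trans ?_
      have : |(l.map fun f => x f.1 - f.2).prod| ≤ (Y + N) ^ (l.map fun f => x f.1 - f.2).length := by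
        refine List.abs_prod_le_pow fun a ha => ?_
        obtain ⟨f, hf, rfl⟩ := List.mem_map.1 ha
        exact (abs_sub _ _).trans (add_le_add (hle _ (hl f hf).1) (hl f hf).2)
      rw [List.length_map] at this
      exact this.trans (pow_le_pow_right₀ (by linarith) hlen)
    have h2 : |c * (R + N) ^ l.length * v| ≤ (Y + N) ^ N := by
      rw [abs_mul, abs_mul, abs_of_nonneg hc0, abs_of_nonneg (by positivity)]
      have h3 : c * (R + N) ^ l.length ≤ (R + N) ^ N :=
        (mul_le_of_le_one_left (by positivity) hc1).trans hMn
      refine (mul_le_of_le_one_right (by positivity) hv1).trans (h3.trans ?_)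
      gcongr
    have h3 : (c * (l.map fun f => x f.1 - f.2).prod - c * (R + N) ^ l.length * v) ^ 2 ≤
        4 * (Y + N) ^ (2 * N) := by
      have h4 : |c * (l.map fun f => x f.1 - f.2).prod - c * (R + N) ^ l.length * v| ≤
          2 * (Y + N) ^ N := (abs_sub _ _).trans (by linarith)
      have h5 := sq_le_sq' (abs_le.1 h4).1 (abs_le.1 h4).2
      refine h5.trans (le_of_eq ?_)
      rw [mul_pow, ← pow_mul, mul_comm N 2]
      norm_num
    have h6 := pow_le_factorial_mul_exp (N := N) hY0 hRY
    nlinarith [sq_nonneg ((R + N) ^ N * η)]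

theorem NeuralNetwork.continuous_realisation {d s : ℕ} (Φ : NeuralNetwork d s) :
    Continuous (Φ.realisation ReLU) := by
  induction Φ with
  | output W b =>
    simp only [NeuralNetwork.realisation]
    exact (Continuous.matrix_mulVec continuous_const continuous_id).add continuous_const
  | layer W b Φ ih =>
    simp only [NeuralNetwork.realisation]
    refine ih.comp (continuous_pi fun i => ?_)
    have h : Continuous fun x => (W.mulVec x + b) i :=
      (continuous_apply i).comp
        ((Continuous.matrix_mulVec continuous_const continuous_id).add continuous_const)
    exact h.max continuous_const

/-- The constant `11` absorbs everything: with `8 ≤ exp 3` and `(2N)! ≤ exp (4N²)`, the exponent is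
at most `3 + 4N - 7N² ≤ 0`. -/
theorem exp_tail_le {N : ℕ} (hN : 1 ≤ N) {δ : ℝ} (hδ : 0 < δ) {s : ℕ} (hs : s ≤ N) :
    4 * ((2 * N).factorial * Real.exp (N - (11 * N ^ 2 + Real.log δ⁻¹))) * Real.exp (3 * s) ≤
      δ / 2 := by
  have hN' : (1 : ℝ) ≤ N := by exact_mod_cast hN
  have hs' : (s : ℝ) ≤ N := by exact_mod_cast hs
  have h1 : ((2 * N).factorial : ℝ) ≤ Real.exp (4 * N ^ 2) := by
    have h2 : ((2 * N).factorial : ℝ) ≤ ((2 * N : ℕ) : ℝ) ^ (2 * N) := by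
      exact_mod_cast Nat.factorial_le_pow _
    have h3 : ((2 * N : ℕ) : ℝ) ≤ Real.exp (2 * N) := by
      have := Real.add_one_le_exp (2 * N : ℝ)
      push_cast; linarith
    refine h2.trans ((pow_le_pow_left₀ (by positivity) h3 _).trans (le_of_eq ?_))
    rw [← Real.exp_nat_mul]
    push_cast; ring_nf
  have h4 : (8 : ℝ) ≤ Real.exp 3 := by
    have : Real.exp 3 = Real.exp 1 ^ 3 := by rw [← Real.exp_nat_mul]; norm_num
    rw [this]
    have h2 : (2 : ℝ) ≤ Real.exp 1 := by have := Real.add_one_le_exp 1; linarith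
    nlinarith [pow_le_pow_left₀ (by norm_num : (0 : ℝ) ≤ 2) h2 3]
  have h5 : Real.exp (N - (11 * N ^ 2 + Real.log δ⁻¹)) = δ * Real.exp (N - 11 * N ^ 2) := by
    rw [Real.log_inv, show (N : ℝ) - (11 * N ^ 2 + -Real.log δ) = Real.log δ + (N - 11 * N ^ 2) by
      ring, Real.exp_add, Real.exp_log hδ]
  rw [h5]
  have h6 : (8 : ℝ) * (2 * N).factorial * Real.exp (N - 11 * N ^ 2) * Real.exp (3 * s) ≤ 1 := by
    calc (8 : ℝ) * (2 * N).factorial * Real.exp (N - 11 * N ^ 2) * Real.exp (3 * s)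
        ≤ Real.exp 3 * Real.exp (4 * N ^ 2) * Real.exp (N - 11 * N ^ 2) * Real.exp (3 * s) := by
          gcongr
      _ = Real.exp (3 + 4 * N ^ 2 + (N - 11 * N ^ 2) + 3 * s) := by
          rw [Real.exp_add, Real.exp_add, Real.exp_add]
      _ ≤ 1 := by
          rw [Real.exp_le_one_iff]
          nlinarith
  nlinarith

/-- ReLU networks approximate products of Hermite polynomials in the Gaussian `L²` norm. -/
theorem exists_network_hermiteProd {m p N K q : ℕ} (hm : 0 < m) (hN : 1 ≤ N) (hq : N ≤ 2 ^ q)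
    (α : Fin p → Fin m → ℕ) (hα : ∀ j, ∑ i, α j i ≤ N) {δ : ℝ} (hδ : 0 < δ) (hδ1 : δ ≤ 1)
    (hK : ((11 * N ^ 2 + Real.log δ⁻¹ + N) ^ N * (2 ^ q * (1 / 4) ^ (K + 1))) ^ 2 ≤ δ / 2) :
    ∃ Φ : NeuralNetwork m p, Φ.depth = 3 + q * (K + 3) ∧
      Φ.size ≤ p * (2 ^ q * (24 * K + 52) + 3) ∧
      ∀ j, Integrable (fun x => (hermiteProd (α j) x - Φ.realisation ReLU x j) ^ 2)
          (stdGaussianPi m) ∧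
        ∫ x, (hermiteProd (α j) x - Φ.realisation ReLU x j) ^ 2 ∂stdGaussianPi m ≤ δ := by
  have hN' : (1 : ℝ) ≤ N := by exact_mod_cast hN
  set R : ℝ := 11 * N ^ 2 + Real.log δ⁻¹ with hRdef
  have hR : 0 ≤ R := by
    have := Real.log_nonneg ((one_le_inv₀ hδ).2 hδ1)
    positivity
  have hM : 0 < R + N := by linarith
  choose l c hc0 hc1 hlen hl hx using fun j => hermiteProd_eq_prod (α j)
  obtain ⟨S, z, hS, hz, hmem, herr⟩ := exists_isHiddenState_prod hm (R := R) K q (Fin p)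
    (fun j => (l j).map fun f => (f.1, (R + N)⁻¹, -f.2 / (R + N)))
    (fun j => by rw [List.length_map, hlen]; exact (hα j).trans hq)
    (by
      intro j f hf x
      obtain ⟨g, hg, rfl⟩ := List.mem_map.1 hf
      have h1 : |g.2| ≤ N := ((hl j g hg).2).trans (by exact_mod_cast hα j)
      have h2 : clampedAffine R x (g.1, (R + N)⁻¹, -g.2 / (R + N)) =
          (clamp R (x g.1) - g.2) / (R + N) := by
        simp only [clampedAffine]; ring
      rw [h2, abs_div, abs_of_pos hM, div_le_one hM]
      exact (abs_sub _ _).trans (add_le_add (abs_clamp_le hR _) h1))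
  -- The output layer recombines the signed product and undoes the division of each factor by `R +
  -- N`.
  obtain ⟨Φ, hdepth, hsize, hΦ⟩ := hz.output (p := p) (c := 2)
    (fun j => ![(j, true), (j, false)])
    (fun j => ![c j * (R + N) ^ (l j).length, -(c j * (R + N) ^ (l j).length)])
  have hreal : ∀ x j, Φ.realisation ReLU x j =
      c j * (R + N) ^ (l j).length * (z x (j, true) - z x (j, false)) := by
    intro x j
    rw [hΦ]
    simp [Fin.sum_univ_two]
    ring
  refine ⟨Φ, by rw [hdepth]; ring, ?_, fun j => ?_⟩
  · rw [Fintype.card_fin] at hS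
    nlinarith
  -- There are at most `N` active coordinates, so the exponential moment is bounded in terms of `N`
  -- alone.
  set s : Finset (Fin m) := Finset.univ.filter fun i => α j i ≠ 0 with hs
  have hscard : s.card ≤ N := by
    refine le_trans ?_ (hα j)
    rw [Finset.card_eq_sum_ones]
    refine (Finset.sum_le_sum fun i hi => ?_).trans (Finset.sum_le_univ_sum_of_nonneg
      fun i => Nat.zero_le _)
    exact Nat.one_le_iff_ne_zero.2 (Finset.mem_filter.1 hi).2
  have hpt : ∀ x, (hermiteProd (α j) x - Φ.realisation ReLU x j) ^ 2 ≤ δ / 2 +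
      4 * ((2 * N).factorial * Real.exp (N - R)) * Real.exp (2 * ∑ i ∈ s, |x i|) := by
    intro x
    rw [hx, hreal]
    have hv1 : |z x (j, true) - z x (j, false)| ≤ 1 := by
      have h1 := hmem x (j, true)
      have h2 := hmem x (j, false)
      exact abs_le.2 ⟨by linarith [h1.1, h2.2], by linarith [h1.2, h2.1]⟩
    have hη : ((2 : ℝ) ^ q - 1) * (1 / 4) ^ (K + 1) ≤ 2 ^ q * (1 / 4) ^ (K + 1) := by
      gcongr
      linarith
    refine (sq_sub_le_of_clamped_approx hN hR (hc0 j) (hc1 j)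
      ((hlen j).le.trans (hα j)) (s := s) (fun f hf => ⟨?_, ?_⟩) hv1
      ((herr x j).trans hη)).trans ?_
    · simp [hs, (hl j f hf).1]
    · exact ((hl j f hf).2).trans (by exact_mod_cast hα j)
    · linarith
  have hint := (integrable_const (μ := stdGaussianPi m) (δ / 2)).add
    ((integrable_exp_two_mul_sum_abs s).const_mul
      (4 * ((2 * N).factorial * Real.exp (N - R))))
  have hcont : Continuous fun x => (hermiteProd (α j) x - Φ.realisation ReLU x j) ^ 2 :=
    ((continuous_hermiteProd _).sub
      ((continuous_apply j).comp Φ.continuous_realisation)).pow 2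
  have hI : Integrable (fun x => (hermiteProd (α j) x - Φ.realisation ReLU x j) ^ 2)
      (stdGaussianPi m) := by
    refine hint.mono' hcont.aestronglyMeasurable (ae_of_all _ fun x => ?_)
    rw [Real.norm_of_nonneg (sq_nonneg _)]
    exact hpt x
  refine ⟨hI, (integral_mono hI hint hpt).trans ?_⟩
  simp only [Pi.add_apply]
  rw [integral_add (integrable_const _) ((integrable_exp_two_mul_sum_abs s).const_mul _),
    integral_const_mul]
  have h1 := integral_exp_two_mul_sum_abs_le s
  have h2 := exp_tail_le hN hδ hscard
  have h3 : 4 * ((2 * N).factorial * Real.exp (N - R)) *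
      ∫ x, Real.exp (2 * ∑ i ∈ s, |x i|) ∂stdGaussianPi m ≤ δ / 2 := by
    refine le_trans ?_ h2
    gcongr
  simp only [integral_const, probReal_univ, one_smul]
  linarith

/-! ### The size and the depth of the approximating networks -/

theorem half_le_log_one_add {N : ℕ} (hN : 1 ≤ N) : 1 / 2 ≤ Real.log (1 + N) := by
  have hN' : (1 : ℝ) ≤ N := by exact_mod_cast hN
  have h := Real.log_le_log (by norm_num) (by linarith : (2 : ℝ) ≤ 1 + N)
  linarith [Real.log_two_gt_d9]

theorem two_pow_clog_le {N : ℕ} (hN : 1 ≤ N) : 2 ^ Nat.clog 2 N ≤ 2 * N := by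
  rcases hN.eq_or_lt with rfl | hN
  · simp
  · have h := Nat.pow_pred_clog_lt_self one_lt_two hN
    have hpos := Nat.clog_pos one_lt_two hN
    obtain ⟨k, hk⟩ := Nat.exists_eq_succ_of_ne_zero hpos.ne'
    rw [hk] at h ⊢
    rw [Nat.succ_eq_add_one, pow_succ]
    simp only [Nat.pred_succ] at h
    omega

theorem clog_two_le_log {N : ℕ} (hN : 1 ≤ N) :
    (Nat.clog 2 N : ℝ) ≤ 3 * Real.log (1 + N) := by
  have hN' : (1 : ℝ) ≤ N := by exact_mod_cast hN
  have h1 : ((2 : ℝ) ^ Nat.clog 2 N) ≤ 2 * N := by exact_mod_cast two_pow_clog_le hN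
  have h2 := Real.log_le_log (by positivity) h1
  rw [Real.log_pow, Real.log_mul (by norm_num) (by positivity)] at h2
  have h3 : Real.log N ≤ Real.log (1 + N) := Real.log_le_log (by linarith) (by linarith)
  have h4 : Real.log 2 ≤ Real.log (1 + N) := Real.log_le_log (by norm_num) (by linarith)
  have h5 := Real.log_two_gt_d9
  nlinarith [Nat.cast_nonneg (α := ℝ) (Nat.clog 2 N)]

/-- The number of sawtooth steps that makes the multiplications accurate enough. -/
theorem exists_sawtooth_steps {N : ℕ} (hN : 1 ≤ N) {δ : ℝ} (hδ : 0 < δ)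
    (hL : 1 ≤ Real.log δ⁻¹) :
    ∃ K : ℕ, ((11 * N ^ 2 + Real.log δ⁻¹ + N) ^ N *
        (2 ^ Nat.clog 2 N * (1 / 4) ^ (K + 1))) ^ 2 ≤ δ / 2 ∧
      (K : ℝ) ≤ 16 * (N * Real.log (1 + N) * Real.log δ⁻¹) := by
  have hN' : (1 : ℝ) ≤ N := by exact_mod_cast hN
  set L := Real.log δ⁻¹ with hLdef
  set ℓ := Real.log (1 + N) with hℓdef
  have hℓ : 1 / 2 ≤ ℓ := half_le_log_one_add hN
  set q := Nat.clog 2 N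
  have hq : (q : ℝ) ≤ 3 * ℓ := clog_two_le_log hN
  set M : ℝ := 11 * N ^ 2 + L + N with hMdef
  have hM : 1 ≤ M := by nlinarith
  have hlogM0 : 0 ≤ Real.log M := Real.log_nonneg hM
  have hlogM : Real.log M ≤ 7 * ℓ + L := by
    have h1 : M ≤ 2 ^ 4 * (1 + N) ^ 2 * L := by
      have h0 : (N : ℝ) ^ 2 ≤ (1 + N) ^ 2 := by gcongr; linarith
      nlinarith [mul_nonneg (by positivity : (0 : ℝ) ≤ N) (by linarith : (0 : ℝ) ≤ L - 1),
        mul_nonneg (by positivity : (0 : ℝ) ≤ (N : ℝ) ^ 2) (by linarith : (0 : ℝ) ≤ L - 1)]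
    have h2 := Real.log_le_log (by linarith) h1
    rw [Real.log_mul (by positivity) (by positivity), Real.log_mul (by positivity) (by positivity),
      Real.log_pow, Real.log_pow] at h2
    have h3 : Real.log L ≤ L := (Real.log_le_sub_one_of_pos (by linarith)).trans (by linarith)
    have h4 : Real.log 2 ≤ ℓ := Real.log_le_log (by norm_num) (by linarith)
    push_cast at h2
    linarith
  -- Chosen so that `exp (-B)` cancels `M ^ N` and `exp q ≥ 2 ^ q` and leaves exactly `δ`; the
  -- additional power in `K + 1` supplies the factor `1 / 4`.
  set B : ℝ := N * Real.log M + q + L with hB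
  have hB0 : 0 ≤ B := by positivity
  refine ⟨⌈B⌉₊, ?_, ?_⟩
  · have hceil := Nat.le_ceil B
    have h1 : M ^ N = Real.exp (N * Real.log M) := by
      rw [Real.exp_nat_mul, Real.exp_log (by linarith)]
    have h2 : (2 : ℝ) ^ q ≤ Real.exp q := by
      rw [← Real.exp_one_pow]
      exact pow_le_pow_left₀ (by norm_num) (by have := Real.add_one_le_exp 1; linarith) _
    have h3 : (1 / 4 : ℝ) ^ ⌈B⌉₊ ≤ Real.exp (-B) := by
      have h4 : (1 / 4 : ℝ) ≤ Real.exp (-1) := by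
        rw [Real.exp_neg, one_div]
        exact inv_anti₀ (Real.exp_pos 1) (by linarith [Real.exp_one_lt_d9])
      refine (pow_le_pow_left₀ (by norm_num) h4 _).trans ?_
      rw [← Real.exp_nat_mul]
      exact Real.exp_le_exp.2 (by linarith)
    have h5 : M ^ N * (2 ^ q * (1 / 4) ^ (⌈B⌉₊ + 1)) ≤ δ / 4 := by
      calc M ^ N * (2 ^ q * (1 / 4) ^ (⌈B⌉₊ + 1))
          ≤ Real.exp (N * Real.log M) * (Real.exp q * (Real.exp (-B) * (1 / 4))) := by
            rw [h1, pow_succ]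
            gcongr
        _ = Real.exp (N * Real.log M + q + -B) / 4 := by
            rw [Real.exp_add, Real.exp_add]; ring
        _ = δ / 4 := by
            rw [show N * Real.log M + q + -B = Real.log δ by
              rw [hB, hLdef, Real.log_inv]; ring, Real.exp_log hδ]
    have hδ1 : δ ≤ 1 := by
      by_contra! h
      have := Real.log_nonpos (by positivity) (inv_le_one_of_one_le₀ h.le)
      linarith
    have h6 : 0 ≤ M ^ N * (2 ^ q * (1 / 4) ^ (⌈B⌉₊ + 1)) := by positivity
    nlinarith
  · have h1 := (Nat.ceil_lt_add_one hB0).le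
    have hNL : 1 ≤ N * L := by nlinarith
    have hNlL : ℓ ≤ N * ℓ * L := by nlinarith
    have h2 : 1 ≤ 2 * (N * ℓ * L) := by linarith
    have h3 : N * Real.log M ≤ 7 * (N * ℓ * L) + 2 * (N * ℓ * L) := by
      have h4 : N * Real.log M ≤ N * (7 * ℓ + L) := by gcongr
      have h5 : (N : ℝ) * ℓ ≤ N * ℓ * L := le_mul_of_one_le_right (by positivity) hL
      have h6 : N * L * (1 / 2) ≤ N * L * ℓ := by gcongr
      nlinarith
    have h4 : L ≤ 2 * (N * ℓ * L) := by
      have h5 : L ≤ N * L := le_mul_of_one_le_left (by linarith) hN'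
      have h6 : N * L * (1 / 2) ≤ N * L * ℓ := by gcongr
      nlinarith
    linarith

theorem exists_network_hermiteProd_of_le {m p N : ℕ} (hm : 0 < m) (hN : 1 ≤ N)
    (α : Fin p → Fin m → ℕ) (hα : ∀ j, ∑ i, α j i ≤ N) {δ : ℝ} (hδ : 0 < δ)
    (hL : 1 ≤ Real.log δ⁻¹) :
    ∃ Φ : NeuralNetwork m p,
      (Φ.depth : ℝ) ≤ 100 * (N * Real.log (1 + N) ^ 2 * Real.log δ⁻¹) ∧
      (Φ.size : ℝ) ≤ 1000 * p * (N ^ 2 * Real.log (1 + N) * Real.log δ⁻¹) ∧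
      ∀ j, Integrable (fun x => (hermiteProd (α j) x - Φ.realisation ReLU x j) ^ 2)
          (stdGaussianPi m) ∧
        ∫ x, (hermiteProd (α j) x - Φ.realisation ReLU x j) ^ 2 ∂stdGaussianPi m ≤ δ := by
  have hN' : (1 : ℝ) ≤ N := by exact_mod_cast hN
  obtain ⟨K, hK, hKle⟩ := exists_sawtooth_steps hN hδ hL
  have hδ1 : δ ≤ 1 := by
    by_contra! h
    have := Real.log_nonpos (by positivity) (inv_le_one_of_one_le₀ h.le)
    linarith
  obtain ⟨Φ, hdepth, hsize, hΦ⟩ := exists_network_hermiteProd hm hN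
    (Nat.le_pow_clog one_lt_two N) α hα hδ hδ1 hK
  have hℓ := half_le_log_one_add hN
  have hq := clog_two_le_log hN
  have h2q : ((2 : ℝ) ^ Nat.clog 2 N) ≤ 2 * N := by exact_mod_cast two_pow_clog_le hN
  set L := Real.log δ⁻¹
  set ℓ := Real.log (1 + N)
  set q := Nat.clog 2 N
  have hNL : 1 ≤ N * L := by nlinarith
  have h2 : 1 ≤ 2 * (N * ℓ * L) := by nlinarith
  refine ⟨Φ, ?_, ?_, hΦ⟩
  · rw [hdepth]
    push_cast
    have h3 : (q : ℝ) * (K + 3) ≤ 3 * ℓ * (22 * (N * ℓ * L)) := by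
      gcongr
      linarith
    have h4 : 1 ≤ 4 * (N * ℓ ^ 2 * L) := by
      have h5 : 1 / 4 ≤ ℓ ^ 2 := by nlinarith
      nlinarith
    nlinarith
  · have h3 : (Φ.size : ℝ) ≤ p * (2 ^ q * (24 * K + 52) + 3) := by exact_mod_cast hsize
    have h4 : (2 : ℝ) ^ q * (24 * K + 52) ≤ 2 * N * (488 * (N * ℓ * L)) := by
      gcongr
      linarith
    have h5 : N * ℓ * L ≤ N ^ 2 * ℓ * L := by
      have : N * ℓ * L ≤ N * (N * ℓ * L) := le_mul_of_one_le_left (by positivity) hN'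
      nlinarith
    have h6 : (2 : ℝ) ^ q * (24 * K + 52) + 3 ≤ 1000 * (N ^ 2 * ℓ * L) := by nlinarith
    calc (Φ.size : ℝ) ≤ p * (2 ^ q * (24 * K + 52) + 3) := h3
      _ ≤ p * (1000 * (N ^ 2 * ℓ * L)) := by gcongr
      _ = _ := by ring

/-! ### Square-integrable network outputs and the passage to the chaos variables -/

/-- Affine maps preserve `L²` and `|ReLU x| ≤ |x|`. For an arbitrary network this shows that the
error integral in the moment bound is a genuine one, not the value `0` assigned to a nonintegrable
function. -/
theorem NeuralNetwork.memLp_realisation {Ω : Type*} [MeasurableSpace Ω] {P : Measure Ω}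
    [IsFiniteMeasure P] {d s : ℕ} (Φ : NeuralNetwork d s) (X : Fin d → Ω → ℝ)
    (hX : ∀ i, MemLp (X i) 2 P) (j : Fin s) :
    MemLp (fun ω => Φ.realisation ReLU (fun i => X i ω) j) 2 P := by
  have affine : ∀ {d s : ℕ} (W : Matrix (Fin s) (Fin d) ℝ) (b : Fin s → ℝ) (X : Fin d → Ω → ℝ),
      (∀ i, MemLp (X i) 2 P) → ∀ j, MemLp (fun ω => (W.mulVec (fun i => X i ω) + b) j) 2 P := by
    intro d s W b X hX j
    simp only [Pi.add_apply, Matrix.mulVec, dotProduct]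
    exact (memLp_finsetSum _ fun i _ => (hX i).const_mul (W j i)).add (memLp_const (b j))
  induction Φ with
  | output W b => exact affine W b X hX j
  | layer W b Φ ih =>
    refine ih (fun i ω => ReLU ((W.mulVec (fun i => X i ω) + b) i)) (fun i => ?_) j
    have h := affine W b X hX i
    refine h.mono (h.1.sup aestronglyMeasurable_const) (ae_of_all _ fun ω => ?_)
    simp only [Real.norm_eq_abs, ReLU]
    rw [abs_of_nonneg (le_max_right _ _)]
    exact max_le (le_abs_self _) (abs_nonneg _)

theorem chaosPoly_eq_hermiteProd {Ω : Type*} (G : ℕ → Ω → ℝ) {m : ℕ} {k : ℕ →₀ ℕ}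
    (hk : ∀ i ∈ k.support, i < m) (ω : Ω) :
    chaosPoly G k ω = hermiteProd (fun i : Fin m => k i) (fun i : Fin m => G i ω) := by
  unfold chaosPoly hermiteProd
  rw [Fin.prod_univ_eq_prod_range (fun i => hermiteH (k i) (G i ω)) m]
  refine Finset.prod_subset (fun i hi => Finset.mem_range.2 (hk i hi)) fun i _ hi => ?_
  rw [Finsupp.notMem_support_iff.1 hi, hermiteH_zero]

theorem sum_support_eq_sum_fin {m : ℕ} {k : ℕ →₀ ℕ} (hk : ∀ i ∈ k.support, i < m) :
    ∑ i ∈ k.support, k i = ∑ i : Fin m, k i := by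
  rw [Fin.sum_univ_eq_sum_range (fun i => k i) m]
  exact Finset.sum_subset (fun i hi => Finset.mem_range.2 (hk i hi)) fun i _ hi =>
    Finsupp.notMem_support_iff.1 hi

theorem log_mul_inv_ge_one {p : ℕ} (hp : 0 < p) {ε : ℝ} (hε : 0 < ε)
    (hε' : ε < Real.exp (-1) / p) : 1 ≤ Real.log (p * ε⁻¹) := by
  have hp' : (0 : ℝ) < p := by exact_mod_cast hp
  have hp1 : (1 : ℝ) ≤ p := by exact_mod_cast hp
  rw [Real.le_log_iff_exp_le (by positivity), ← div_eq_mul_inv, le_div_iff₀ hε]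
  rw [lt_div_iff₀ hp', Real.exp_neg] at hε'
  have he := Real.exp_pos 1
  have h1 : ε ≤ (Real.exp 1)⁻¹ := (le_mul_of_one_le_right hε.le hp1).trans hε'.le
  calc Real.exp 1 * ε ≤ Real.exp 1 * (Real.exp 1)⁻¹ := by gcongr
    _ = 1 := mul_inv_cancel₀ he.ne'
    _ ≤ p := hp1

end

theorem corollary4p8 :
    ∃ C : ℝ, 0 < C ∧
      ∀ (Ω : Type*) [MeasurableSpace Ω] (P : Measure Ω) [IsProbabilityMeasure P]
        -- the Brownian motion, an orthonormal system and its Wiener integrals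
        (T : ℝ≥0) (_ : 0 < T) (W : ℝ≥0 → Ω → ℝ) (_ : IsBrownianMotionOn T W P)
        (e : ℕ → L2Time T) (_ : Orthonormal ℝ e)
        (G : ℕ → Ω → ℝ) (_ : ∀ i, IsWienerIntegral W P (e i) (G i))
        -- the multi-indices, which only involve the network inputs `G 0, …, G (m - 1)`
        (m p : ℕ) (_ : 0 < m) (_ : 0 < p) (k : Fin p → ℕ →₀ ℕ)
        (_ : ∀ j, ∀ i ∈ (k j).support, i < m)
        (ε : ℝ) (_ : 0 < ε) (_ : ε < Real.exp (-1) / p),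
        (∃ Φ : NeuralNetwork m p,
          Integrable (fun ω => ∑ j, |chaosPoly G (k j) ω -
            Φ.realisation ReLU (fun i => G i ω) j| ^ 2) P ∧
          ∫ ω, ∑ j, |chaosPoly G (k j) ω - Φ.realisation ReLU (fun i => G i ω) j| ^ 2 ∂P ≤ ε ∧
          ((∃ j, k j ≠ 0) →
            (Φ.size : ℝ) ≤ C * p *
              (⨆ j, multiOrder (k j) ^ 3 * Real.log (1 + multiOrder (k j)) *
                multiSupp (k j) ^ 2) * Real.log (p * ε⁻¹) ∧
            (Φ.depth : ℝ) ≤ C *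
              (⨆ j, multiOrder (k j) * Real.log (1 + multiOrder (k j)) ^ 2 *
                multiSupp (k j) * Real.log (1 + multiSupp (k j))) * Real.log (p * ε⁻¹))) ∧
        ∀ Φ : NeuralNetwork m p,
          ∫ ω, ∑ j, |chaosPoly G (k j) ω - Φ.realisation ReLU (fun i => G i ω) j| ^ 2 ∂P ≤ ε →
          (∀ j, Integrable (fun ω => |Φ.realisation ReLU (fun i => G i ω) j| ^ 2) P) ∧
          ∑ j, ∫ ω, |Φ.realisation ReLU (fun i => G i ω) j| ^ 2 ∂P ≤ 2 * (ε + p) := by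
  -- The size estimate dictates the constant; the depth needs only `200`.
  refine ⟨1000, by norm_num, ?_⟩
  intro Ω _ P _ T _ W hW e he G hG m p hm hp k hk ε hε hε'
  have hp' : (0 : ℝ) < p := by exact_mod_cast hp
  have hlaw : HasLaw (fun ω (i : Fin m) => G i ω) (stdGaussianPi m) P :=
    IsWienerIntegral.hasLaw_pi hW he hG m
  have htransfer : ∀ f : (Fin m → ℝ) → ℝ, Continuous f → Integrable f (stdGaussianPi m) →
      Integrable (fun ω => f (fun i => G i ω)) P := by
    intro f hf h
    rw [← hlaw.map_eq, integrable_map_measure hf.aestronglyMeasurable hlaw.aemeasurable] at h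
    exact h
  have hexp : ∀ f : (Fin m → ℝ) → ℝ, Continuous f →
      ∫ ω, f (fun i => G i ω) ∂P = ∫ x, f x ∂stdGaussianPi m := fun f hf =>
    hlaw.integral_comp hf.aestronglyMeasurable
  have hL := log_mul_inv_ge_one hp hε hε'
  have hLeq : Real.log (ε / p)⁻¹ = Real.log (p * ε⁻¹) := by rw [inv_div, div_eq_mul_inv]
  have hchaos : ∀ j ω, chaosPoly G (k j) ω =
      hermiteProd (fun i : Fin m => k j i) (fun i : Fin m => G i ω) := fun j ω =>
    chaosPoly_eq_hermiteProd G (hk j) ω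
  simp only [sq_abs]
  constructor
  · have hsumk : ∀ j, ∑ i : Fin m, k j i = ∑ i ∈ (k j).support, k j i := fun j =>
      (sum_support_eq_sum_fin (hk j)).symm
    -- The `max` with `1` covers the case where all multi-indices vanish, in which a network is
    -- still required.
    set N : ℕ := max 1 (Finset.univ.sup fun j => ∑ i ∈ (k j).support, k j i) with hN
    have hle : ∀ j, ∑ i : Fin m, k j i ≤ N := by
      intro j
      rw [hsumk]
      exact (Finset.le_sup (f := fun j => ∑ i ∈ (k j).support, k j i) (Finset.mem_univ j)).trans
        (le_max_right _ _)
    obtain ⟨Φ, hdepth, hsize, hΦ⟩ := exists_network_hermiteProd_of_le hm (le_max_left _ _ : 1 ≤ N)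
      (fun j (i : Fin m) => k j i) hle (div_pos hε hp') (by rw [hLeq]; exact hL)
    rw [hLeq] at hdepth hsize
    have hcont : ∀ j, Continuous fun x => (hermiteProd (fun i : Fin m => k j i) x -
        Φ.realisation ReLU x j) ^ 2 := fun j =>
      ((continuous_hermiteProd _).sub ((continuous_apply j).comp Φ.continuous_realisation)).pow 2
    have hint : ∀ j, Integrable (fun ω => (chaosPoly G (k j) ω -
        Φ.realisation ReLU (fun i => G i ω) j) ^ 2) P := by
      intro j
      simp only [hchaos]
      exact htransfer _ (hcont j) (hΦ j).1
    have hval : ∀ j, ∫ ω, (chaosPoly G (k j) ω -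
        Φ.realisation ReLU (fun i => G i ω) j) ^ 2 ∂P ≤ ε / p := by
      intro j
      simp only [hchaos]
      exact (hexp _ (hcont j)).trans_le (hΦ j).2
    refine ⟨Φ, integrable_finsetSum _ fun j _ => hint j, ?_, ?_⟩
    · rw [integral_finsetSum _ fun j _ => hint j]
      refine (Finset.sum_le_sum fun j _ => hval j).trans (le_of_eq ?_)
      simp
      field_simp
    · rintro ⟨j₁, hj₁⟩
      have hne : (Finset.univ : Finset (Fin p)).Nonempty := ⟨j₁, Finset.mem_univ _⟩
      obtain ⟨j₀, -, hj₀⟩ := Finset.exists_mem_eq_sup _ hne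
        (fun j => ∑ i ∈ (k j).support, k j i)
      have hpos : ∀ j, k j ≠ 0 → 1 ≤ ∑ i ∈ (k j).support, k j i := by
        intro j hj
        obtain ⟨i, hi⟩ := Finsupp.support_nonempty_iff.2 hj
        exact (Nat.one_le_iff_ne_zero.2 (Finsupp.mem_support_iff.1 hi)).trans
          (Finset.single_le_sum (f := k j) (fun _ _ => Nat.zero_le _) hi)
      -- Some multi-index is nonzero here, so the `max` with `1` is inactive and `N` is the order
      -- attained at `j₀`.
      have hN₀ : N = ∑ i ∈ (k j₀).support, k j₀ i := by
        rw [hN, hj₀]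
        refine max_eq_right ?_
        rw [← hj₀]
        exact (hpos j₁ hj₁).trans
          (Finset.le_sup (f := fun j => ∑ i ∈ (k j).support, k j i) (Finset.mem_univ j₁))
      have hN1 : 1 ≤ N := le_max_left _ _
      have horder : multiOrder (k j₀) = N := by rw [multiOrder, hN₀]
      have hsupp : 1 ≤ multiSupp (k j₀) := by
        have : k j₀ ≠ 0 := by
          intro h
          rw [h] at hN₀
          simp at hN₀
          omega
        unfold multiSupp
        exact_mod_cast Finset.card_pos.2 (Finsupp.support_nonempty_iff.2 this)
      have hN' : (1 : ℝ) ≤ N := by exact_mod_cast hN1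
      have hℓ := half_le_log_one_add hN1
      set ℓ := Real.log (1 + (N : ℝ))
      set L := Real.log (p * ε⁻¹)
      constructor
      · have h1 := le_ciSup (Set.finite_range fun j => multiOrder (k j) ^ 3 *
          Real.log (1 + multiOrder (k j)) * multiSupp (k j) ^ 2).bddAbove j₀
        rw [horder] at h1
        have h2 : (N : ℝ) ^ 2 * ℓ ≤ N ^ 3 * ℓ * multiSupp (k j₀) ^ 2 := by
          have h3 : (N : ℝ) ^ 2 ≤ N ^ 3 := pow_le_pow_right₀ hN' (by norm_num)
          have h4 : (N : ℝ) ^ 2 * ℓ ≤ N ^ 3 * ℓ := by gcongr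
          exact h4.trans (le_mul_of_one_le_right (by positivity) (one_le_pow₀ hsupp))
        refine hsize.trans ?_
        rw [← mul_assoc]
        gcongr
        exact h2.trans h1
      · have h1 := le_ciSup (Set.finite_range fun j => multiOrder (k j) *
          Real.log (1 + multiOrder (k j)) ^ 2 * multiSupp (k j) *
            Real.log (1 + multiSupp (k j))).bddAbove j₀
        rw [horder] at h1
        -- The factor `2` compensates for `log (1 + |k|₀)`, which may be below `1` but is at least
        -- `log 2 ≥ 1 / 2`.
        have h2 : (N : ℝ) * ℓ ^ 2 ≤ 2 * (N * ℓ ^ 2 * multiSupp (k j₀) *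
            Real.log (1 + multiSupp (k j₀))) := by
          have h3 : 1 / 2 ≤ Real.log (1 + multiSupp (k j₀)) := by
            have h := Real.log_le_log (by norm_num) (by linarith : (2 : ℝ) ≤ 1 + multiSupp (k j₀))
            linarith [Real.log_two_gt_d9]
          have h4 : 1 / 2 ≤ multiSupp (k j₀) * Real.log (1 + multiSupp (k j₀)) :=
            h3.trans (le_mul_of_one_le_left (by linarith) hsupp)
          have h5 : (N : ℝ) * ℓ ^ 2 * (1 / 2) ≤ N * ℓ ^ 2 *
              (multiSupp (k j₀) * Real.log (1 + multiSupp (k j₀))) := by gcongr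
          linarith
        have h6 := h2.trans (mul_le_mul_of_nonneg_left h1 zero_le_two)
        have h7 : (N : ℝ) * ℓ ^ 2 * L ≤ 2 * (⨆ j, multiOrder (k j) *
          Real.log (1 + multiOrder (k j)) ^ 2 * multiSupp (k j) *
            Real.log (1 + multiSupp (k j))) * L := by gcongr
        have h8 : 0 ≤ (N : ℝ) * ℓ ^ 2 * L := by positivity
        linarith
  · intro Φ hΦ
    have hR : ∀ j, MemLp (fun ω => Φ.realisation ReLU (fun i => G i ω) j) 2 P := fun j =>
      Φ.memLp_realisation (fun i => G i) (fun i => (hG i).1) j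
    have hc : ∀ j, AEStronglyMeasurable (fun ω => chaosPoly G (k j) ω) P := by
      intro j
      simp only [hchaos]
      exact (continuous_hermiteProd _).comp_aestronglyMeasurable
        hlaw.aemeasurable.aestronglyMeasurable
    have hcsq : ∀ j, Integrable (fun ω => chaosPoly G (k j) ω ^ 2) P := by
      intro j
      simp only [hchaos]
      exact htransfer _ ((continuous_hermiteProd _).pow 2) (integrable_hermiteProd_sq _)
    have hcval : ∀ j, ∫ ω, chaosPoly G (k j) ω ^ 2 ∂P = 1 := by
      intro j
      simp only [hchaos]
      exact (hexp _ ((continuous_hermiteProd _).pow 2)).trans (integral_hermiteProd_sq _)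
    have hcL : ∀ j, MemLp (fun ω => chaosPoly G (k j) ω) 2 P := fun j =>
      (memLp_two_iff_integrable_sq (hc j)).2 (hcsq j)
    have hRsq : ∀ j, Integrable (fun ω => Φ.realisation ReLU (fun i => G i ω) j ^ 2) P :=
      fun j => (hR j).integrable_sq
    have hdsq : ∀ j, Integrable (fun ω => (chaosPoly G (k j) ω -
        Φ.realisation ReLU (fun i => G i ω) j) ^ 2) P := fun j => ((hcL j).sub (hR j)).integrable_sq
    refine ⟨hRsq, ?_⟩
    have hj : ∀ j, ∫ ω, Φ.realisation ReLU (fun i => G i ω) j ^ 2 ∂P ≤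
        2 * ∫ ω, (chaosPoly G (k j) ω - Φ.realisation ReLU (fun i => G i ω) j) ^ 2 ∂P + 2 := by
      intro j
      have h1 : ∫ ω, Φ.realisation ReLU (fun i => G i ω) j ^ 2 ∂P ≤
          ∫ ω, (2 * (chaosPoly G (k j) ω - Φ.realisation ReLU (fun i => G i ω) j) ^ 2 +
            2 * chaosPoly G (k j) ω ^ 2) ∂P := by
        refine integral_mono (hRsq j) (((hdsq j).const_mul 2).add ((hcsq j).const_mul 2))
          fun ω => ?_
        -- The right side minus the left side is exactly this square.
        nlinarith [sq_nonneg (2 * chaosPoly G (k j) ω - Φ.realisation ReLU (fun i => G i ω) j)]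
      rw [integral_add ((hdsq j).const_mul 2) ((hcsq j).const_mul 2), integral_const_mul,
        integral_const_mul, hcval] at h1
      linarith
    rw [integral_finsetSum _ fun j _ => hdsq j] at hΦ
    calc ∑ j, ∫ ω, Φ.realisation ReLU (fun i => G i ω) j ^ 2 ∂P
        ≤ ∑ j, (2 * ∫ ω, (chaosPoly G (k j) ω -
            Φ.realisation ReLU (fun i => G i ω) j) ^ 2 ∂P + 2) := Finset.sum_le_sum fun j _ => hj j
      _ = 2 * ∑ j, ∫ ω, (chaosPoly G (k j) ω -
            Φ.realisation ReLU (fun i => G i ω) j) ^ 2 ∂P + 2 * p := by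
          rw [Finset.sum_add_distrib, ← Finset.mul_sum]
          simp [mul_comm]
      _ ≤ 2 * (ε + p) := by linarith
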